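/- Let $n\ge 1$ and $N\ge 0$ be integers, let $\mathbb T^{n+N}=\mathbb R^{n+N}/2\pi\mathbb Z^{n+N}$ with coordinates $(t,x)=(t_1,\dots,t_n,x_1,\dots,x_N)$, and for $j=1,\dots,n$ let $P_j(D_x)u=\sum_{\xi\in\mathbb Z^N}p_j(\xi)\,\widehat u(t,\xi)\,e^{i\xi\cdot x}$, where $p_j:\mathbb Z^N\to\mathbb C$ is a toroidal symbol of some order $m_j\in\mathbb R$, i.e. for every multi-index $\alpha$ there is $C_\alpha$ with $|\Delta^\alpha_\xi p_j(\xi)|\le C_\alpha(1+|\xi|^2)^{(m_j-|\alpha|)/2}$ for all $\xi\in\mathbb Z^N$ ($\Delta_\xi$ being forward differences). Put $L_j=D_{t_j}+P_j(D_x)$ with $D_{t_j}=-i\partial_{t_j}$. For $p\ge 0$ let $\mathbb L^p$ act on $p$-currents $u=\sum_{|K|=p}u_K\,dt_K$, $u_K\in\mathcal D'(\mathbb T^{n+N})$ (forms in $dt_1,\dots,dt_n$ only), by $$\mathbb L^p u=\sum_{j=1}^n\sum_{|K|=p}(iL_ju_K)\,dt_j\wedge dt_K,$$ that is, $\mathbb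 L^p=d_t+c(D_x)\wedge$ with $c(D_x)\wedge u=\sum_{j}\sum_{|K|=p} iP_j(D_x)u_K\,dt_j\wedge dt_K$. For $\xi\in\mathbb Z^N$ let $c_{\xi 0}=\sum_{j}p_j(\xi)\,dt_j$; it is called integral if it is real and $\frac1{2\pi}\int_\sigma c_{\xi0}\in\mathbb Z$ for every $1$-cycle $\sigma$ in $\mathbb T^n$. Let $\mathbb E^p$ be the set of all smooth $(p+1)$-forms $f=\sum_{|J|=p+1}f_J\,dt_J$, $f_J\in C^\infty(\mathbb T^{n+N})$, such that $\mathbb L^{p+1}f=0$ and such that, for every $\xi\in\mathbb Z^N$ for which $c_{\xi0}$ is integral, the form $\widehat f(t,\xi)\,e^{i\psi_\xi(t)}$ is exact on $\mathbb T^n$; here $\widehat f(t,\xi)$ is the partial Fourier coefficient of $f$ in $x$, and $\psi_\xi\in C^\infty(\mathbb R^n;\mathbb R)$ satisfies $d\psi_\xi=c_{\xi 0}$ on $\mathbb R^n$. The operator $\mathbb L^p$ is called globally solvable if for every $f\in\mathbb E^p$ there is a $p$-current $u=\sum_{|K|=p}u_K\,dt_K$ with $u_K\in\mathcal D'(\mathbb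 T^{n+N})$ and $\mathbb L^pu=f$. Then, for each $p=0,1,\dots,n-1$, the operator $\mathbb L^p$ is globally solvable if and only if there exist constants $C>0$ and $\lambda>0$ such that $$\max_{1\le j\le n}|\eta_j+p_j(\xi)|\ \ge\ C\,|(\eta,\xi)|^{-\lambda}$$ for all $(\eta,\xi)\in\mathbb Z^{n}\times\mathbb Z^N$ with $(\eta,\xi)\ne(0,0)$ and $\max_{1\le j\le n}|\eta_j+p_j(\xi)|\neq 0$. -/

import Mathlib

open scoped ContDiff

noncomputable section

namespace ToroidalComplex

/-! ### Smooth functions and distributions on the torus `ℝ^ι / 2πℤ^ι` -/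

section Torus

set_option linter.unusedSectionVars false

variable {ι : Type} [Fintype ι] [DecidableEq ι]

/-- `C^∞(𝕋^ι)`: the complex-valued smooth functions on `ℝ^ι` that are `2π`-periodic in every
variable. -/
def Smooth (ι : Type) [Fintype ι] : Submodule ℂ ((ι → ℝ) → ℂ) where
  carrier := {φ | ContDiff ℝ ∞ φ ∧
    ∀ (k : ι → ℤ) (x : ι → ℝ), φ (x + fun i => 2 * Real.pi * (k i : ℝ)) = φ x}
  add_mem' := by
    rintro f g ⟨hf, hf'⟩ ⟨hg, hg'⟩
    exact ⟨hf.add hg, fun k x => by simp only [Pi.add_apply, hf' k x, hg' k x]⟩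
  zero_mem' := ⟨contDiff_const, fun _ _ => rfl⟩
  smul_mem' := by
    rintro c f ⟨hf, hf'⟩
    exact ⟨contDiff_const.smul hf, fun k x => by simp only [Pi.smul_apply, hf' k x]⟩

/-- The integral over a period cell, `∫_{𝕋^ι} g`. -/
def torusIntegral (g : (ι → ℝ) → ℂ) : ℂ :=
  ∫ x in Set.Icc (0 : ι → ℝ) (fun _ => 2 * Real.pi), g x

theorem smooth_differentiable (φ : Smooth ι) : Differentiable ℝ φ.1 :=
  φ.2.1.differentiable (by simp)

/-- The partial derivative `∂_j` on `C^∞(𝕋^ι)`. -/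
def pderiv (j : ι) : Smooth ι →ₗ[ℂ] Smooth ι where
  toFun φ := ⟨fun x => fderiv ℝ φ.1 x (Pi.single j 1), by
    refine ⟨?_, fun k x => ?_⟩
    · exact (φ.2.1.fderiv_right (m := ∞) (by simp)).clm_apply contDiff_const
    · change fderiv ℝ φ.1 _ _ = fderiv ℝ φ.1 _ _
      have h : (fun y => φ.1 (y + fun i => 2 * Real.pi * (k i : ℝ))) = φ.1 :=
        funext (φ.2.2 k)
      have h2 := fderiv_comp_add_right (𝕜 := ℝ) (f := φ.1) (x := x)
        (fun i => 2 * Real.pi * (k i : ℝ))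
      rw [h] at h2
      rw [← h2]⟩
  map_add' φ ψ := by
    ext x
    change fderiv ℝ (φ.1 + ψ.1) x _ = fderiv ℝ φ.1 x _ + fderiv ℝ ψ.1 x _
    simp [fderiv_add (smooth_differentiable φ x) (smooth_differentiable ψ x)]
  map_smul' c φ := by
    ext x
    change fderiv ℝ (c • φ.1) x _ = c • fderiv ℝ φ.1 x _
    simp [fderiv_const_smul (smooth_differentiable φ x)]

/-- The iterated partial derivative `∂_{w₁} ∂_{w₂} ⋯ ∂_{w_r}`. -/
def iterPderiv (w : List ι) (φ : Smooth ι) : Smooth ι :=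
  w.foldr (fun j ψ => pderiv j ψ) φ

/-- All partial derivatives of `φ` of order at most `k` are bounded by `M`. -/
def DerivBound (k : ℕ) (M : ℝ) (φ : Smooth ι) : Prop :=
  ∀ w : List ι, w.length ≤ k → ∀ x, ‖(iterPderiv w φ).1 x‖ ≤ M

theorem DerivBound.mono {k l : ℕ} {M : ℝ} {φ : Smooth ι} (h : DerivBound l M φ) (hkl : k ≤ l) :
    DerivBound k M φ := fun w hw => h w (hw.trans hkl)

theorem DerivBound.nonneg {k : ℕ} {M : ℝ} {φ : Smooth ι} (h : DerivBound k M φ) : 0 ≤ M :=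
  (norm_nonneg _).trans (h [] (by simp) 0)

theorem iterPderiv_pderiv (w : List ι) (j : ι) (φ : Smooth ι) :
    iterPderiv w (pderiv j φ) = iterPderiv (w ++ [j]) φ := by
  simp [iterPderiv]

theorem DerivBound.pderiv {k : ℕ} {M : ℝ} {φ : Smooth ι} (h : DerivBound (k + 1) M φ) (j : ι) :
    DerivBound k M (pderiv j φ) := fun w hw x => by
  rw [iterPderiv_pderiv]
  exact h _ (by simpa using hw) x

/-- `𝒟'(𝕋^ι)`: the linear functionals `u` on `C^∞(𝕋^ι)` that are continuous for its Fréchet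
topology, i.e. `|u(φ)| ≤ C max_{|α| ≤ k} sup |∂^α φ|` for some `k` and `C`. -/
def Distr (ι : Type) [Fintype ι] [DecidableEq ι] : Submodule ℂ (Smooth ι →ₗ[ℂ] ℂ) where
  carrier := {u | ∃ (k : ℕ) (C : ℝ), ∀ (φ : Smooth ι) (M : ℝ), DerivBound k M φ → ‖u φ‖ ≤ C * M}
  add_mem' := by
    rintro u v ⟨k, C, hu⟩ ⟨l, D, hv⟩
    refine ⟨max k l, C + D, fun φ M h => ?_⟩
    have h1 := hu φ M (h.mono (le_max_left _ _))
    have h2 := hv φ M (h.mono (le_max_right _ _))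
    calc ‖(u + v) φ‖ ≤ ‖u φ‖ + ‖v φ‖ := norm_add_le _ _
      _ ≤ (C + D) * M := by linarith
  zero_mem' := ⟨0, 0, fun φ M _ => by simp⟩
  smul_mem' := by
    rintro c u ⟨k, C, hu⟩
    refine ⟨k, ‖c‖ * C, fun φ M h => ?_⟩
    calc ‖(c • u) φ‖ = ‖c‖ * ‖u φ‖ := by simp
      _ ≤ ‖c‖ * (C * M) := by gcongr; exact hu φ M h
      _ = ‖c‖ * C * M := by ring

/-- The partial derivative of a distribution, `⟨∂_j u, φ⟩ = -⟨u, ∂_j φ⟩`. -/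
def Distr.pderiv (j : ι) : Distr ι →ₗ[ℂ] Distr ι where
  toFun u := ⟨-(u.1.comp (ToroidalComplex.pderiv j)), by
    obtain ⟨k, C, hu⟩ := u.2
    refine ⟨k + 1, C, fun φ M h => ?_⟩
    simpa using hu _ M (h.pderiv j)⟩
  map_add' u v := by
    ext φ
    change -((u.1 + v.1) _) = -(u.1 _) + -(v.1 _)
    rw [LinearMap.add_apply, neg_add]
  map_smul' c u := by
    ext φ
    change -((c • u.1) _) = c • -(u.1 _)
    rw [LinearMap.smul_apply, smul_neg]

theorem integrableOn_cell {g : (ι → ℝ) → ℂ} (hg : Continuous g) :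
    MeasureTheory.IntegrableOn g (Set.Icc (0 : ι → ℝ) (fun _ => 2 * Real.pi)) :=
  hg.continuousOn.integrableOn_compact isCompact_Icc

theorem norm_torusIntegral_le {g : (ι → ℝ) → ℂ} {M : ℝ} (hM : ∀ x, ‖g x‖ ≤ M) :
    ‖torusIntegral g‖
      ≤ M * MeasureTheory.volume.real (Set.Icc (0 : ι → ℝ) (fun _ => 2 * Real.pi)) :=
  MeasureTheory.norm_setIntegral_le_of_norm_le_const
    isCompact_Icc.measure_lt_top (fun x _ => hM x)

theorem exists_bound (f : Smooth ι) : ∃ B : ℝ, ∀ x ∈ Set.Icc (0 : ι → ℝ) (fun _ => 2 * Real.pi),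
    ‖f.1 x‖ ≤ B :=
  isCompact_Icc.exists_bound_of_continuousOn f.2.1.continuous.continuousOn

/-- The embedding `C^∞(𝕋^ι) ⊆ 𝒟'(𝕋^ι)`, `⟨f, φ⟩ = ∫_{𝕋^ι} f φ`. -/
def ofSmooth (f : Smooth ι) : Distr ι :=
  ⟨{ toFun := fun φ => torusIntegral fun x => f.1 x * φ.1 x
     map_add' := fun φ ψ => by
       simp only [torusIntegral, Submodule.coe_add, Pi.add_apply, mul_add]
       exact MeasureTheory.integral_add
         (integrableOn_cell (f.2.1.continuous.mul φ.2.1.continuous))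
         (integrableOn_cell (f.2.1.continuous.mul ψ.2.1.continuous))
     map_smul' := fun c φ => by
       simp only [torusIntegral, Submodule.coe_smul, Pi.smul_apply, smul_eq_mul, RingHom.id_apply]
       rw [← MeasureTheory.integral_const_mul]
       exact MeasureTheory.integral_congr_ae (Filter.Eventually.of_forall fun x => by ring) }, by
    obtain ⟨B, hB⟩ := exists_bound f
    refine ⟨0, B * MeasureTheory.volume.real (Set.Icc (0 : ι → ℝ) (fun _ => 2 * Real.pi)),
      fun φ M h => ?_⟩
    have h0 : ∀ x, ‖φ.1 x‖ ≤ M := h [] (by simp)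
    have h1 : ‖∫ x in Set.Icc (0 : ι → ℝ) (fun _ => 2 * Real.pi), f.1 x * φ.1 x‖
        ≤ (B * M) * MeasureTheory.volume.real (Set.Icc (0 : ι → ℝ) (fun _ => 2 * Real.pi)) := by
      refine MeasureTheory.norm_setIntegral_le_of_norm_le_const isCompact_Icc.measure_lt_top
        fun x hx => ?_
      rw [norm_mul]
      exact mul_le_mul (hB x hx) (h0 x) (norm_nonneg _) ((norm_nonneg _).trans (hB x hx))
    calc _ ≤ _ := h1
      _ = _ := by ring⟩

/-- The character `e_ν(x) = e^{i ν·x}`. -/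
def char (ν : ι → ℤ) : Smooth ι :=
  ⟨fun x => Complex.exp (Complex.I * ((∑ i, (ν i : ℝ) * x i : ℝ) : ℂ)), by
    refine ⟨?_, fun k x => ?_⟩
    · have h : ContDiff ℝ ∞ fun x : ι → ℝ => (∑ i, (ν i : ℝ) * x i : ℝ) := by fun_prop
      exact (contDiff_const.mul (Complex.ofRealCLM.contDiff.comp h)).cexp
    · rw [Complex.exp_eq_exp_iff_exists_int]
      refine ⟨∑ i, ν i * k i, ?_⟩
      simp only [Pi.add_apply, mul_add, Finset.sum_add_distrib]
      push_cast
      rw [mul_add, Finset.mul_sum (a := Complex.I), Finset.mul_sum (a := Complex.I),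
        Finset.sum_mul]
      congr 1
      exact Finset.sum_congr rfl fun i _ => by ring⟩

/-- The Fourier coefficient `û(ν) = (2π)^{-|ι|} ⟨u, e^{-iν·x}⟩` of a distribution. -/
def coeff (u : Distr ι) (ν : ι → ℤ) : ℂ :=
  ((2 * Real.pi : ℝ) : ℂ)⁻¹ ^ Fintype.card ι * u.1 (char (-ν))

/-! ### Fourier multipliers on distributions -/

/-- The weight `1 + |ν|²`. -/
def weight (ν : ι → ℤ) : ℝ := 1 + ∑ i, (ν i : ℝ) ^ 2

theorem one_le_weight (ν : ι → ℤ) : 1 ≤ weight ν := by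
  unfold weight
  have : 0 ≤ ∑ i, (ν i : ℝ) ^ 2 := Finset.sum_nonneg fun i _ => sq_nonneg _
  linarith

theorem weight_neg (ν : ι → ℤ) : weight (-ν) = weight ν := by simp [weight]

theorem abs_le_weight (ν : ι → ℤ) (j : ι) : |(ν j : ℝ)| ≤ weight ν := by
  have h : (ν j : ℝ) ^ 2 ≤ ∑ i, (ν i : ℝ) ^ 2 :=
    Finset.single_le_sum (f := fun i => (ν i : ℝ) ^ 2) (fun i _ => sq_nonneg _) (Finset.mem_univ j)
  unfold weight
  nlinarith [sq_abs (ν j : ℝ), sq_nonneg (|(ν j : ℝ)| - 1)]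

theorem pderiv_char (ν : ι → ℤ) (j : ι) :
    pderiv j (char ν) = (Complex.I * (ν j : ℂ)) • char ν := by
  ext x
  have h1 : HasFDerivAt (fun x : ι → ℝ => ((∑ i, (ν i : ℝ) * x i : ℝ) : ℂ))
      (Complex.ofRealCLM.comp (∑ i, (ν i : ℝ) • ContinuousLinearMap.proj (R := ℝ) i)) x := by
    refine Complex.ofRealCLM.hasFDerivAt.comp x ?_
    refine HasFDerivAt.fun_sum fun i _ => ?_
    exact (hasFDerivAt_apply i x).const_mul (ν i : ℝ)
  have h2 := ((h1.const_mul Complex.I).cexp).fderiv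
  change fderiv ℝ (fun x : ι → ℝ => Complex.exp (Complex.I * ((∑ i, (ν i : ℝ) * x i : ℝ) : ℂ))) x
    (Pi.single j 1) = _
  rw [h2]
  simp [char, Pi.single_apply, mul_comm]

theorem derivBound_char (ν : ι → ℤ) (k : ℕ) : DerivBound k (weight ν ^ k) (char ν) := by
  intro w hw x
  have key : ∀ w : List ι, ‖(iterPderiv w (char ν)).1 x‖ ≤ weight ν ^ w.length := by
    intro w
    have : ∃ c : ℂ, ‖c‖ ≤ weight ν ^ w.length ∧ iterPderiv w (char ν) = c • char ν := by
      induction w with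
      | nil => exact ⟨1, by simp, by simp [iterPderiv]⟩
      | cons j w ih =>
        obtain ⟨c, hc, h⟩ := ih
        refine ⟨c * (Complex.I * (ν j : ℂ)), ?_, ?_⟩
        · rw [norm_mul, norm_mul, Complex.norm_I, one_mul, List.length_cons, pow_succ]
          refine mul_le_mul hc ?_ (norm_nonneg _) (pow_nonneg (by linarith [one_le_weight ν]) _)
          simpa using abs_le_weight ν j
        · change pderiv j (iterPderiv w (char ν)) = _
          rw [h, map_smul, pderiv_char, smul_smul]
    obtain ⟨c, hc, h⟩ := this
    rw [h]
    have h1 : ‖(char ν).1 x‖ = 1 := by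
      simp only [char]
      rw [mul_comm]
      exact Complex.norm_exp_ofReal_mul_I _
    change ‖c * (char ν).1 x‖ ≤ _
    rw [norm_mul, h1, mul_one]
    exact hc
  exact (key w).trans (pow_le_pow_right₀ (one_le_weight ν) hw)

theorem exists_coeff_bound (u : Distr ι) :
    ∃ (C : ℝ) (k : ℕ), 0 ≤ C ∧ ∀ ν, ‖coeff u ν‖ ≤ C * weight ν ^ k := by
  obtain ⟨k, C, hu⟩ := u.2
  refine ⟨‖((2 * Real.pi : ℝ) : ℂ)⁻¹ ^ Fintype.card ι‖ * |C|, k, by positivity, fun ν => ?_⟩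
  have h1 := hu _ _ (derivBound_char (-ν) k)
  rw [weight_neg] at h1
  have h2 : 0 ≤ weight ν ^ k := pow_nonneg (by linarith [one_le_weight ν]) _
  rw [coeff, norm_mul, mul_assoc]
  gcongr
  exact h1.trans (mul_le_mul_of_nonneg_right (le_abs_self C) h2)

open scoped Pointwise in
theorem torusIntegral_translate (φ : Smooth ι) (v : ι → ℝ) :
    torusIntegral (fun x => φ.1 (x + v)) = torusIntegral φ.1 := by
  have hpi : (2 * Real.pi) ≠ 0 := by positivity
  have hpi0 : 0 < 2 * Real.pi := by positivity
  let b : Module.Basis ι ℝ (ι → ℝ) :=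
    (Pi.basisFun ℝ ι).unitsSMul fun _ => Units.mk0 (2 * Real.pi) hpi
  have hb : ∀ i, b i = Pi.single i (2 * Real.pi) := fun i => by
    rw [Module.Basis.unitsSMul_apply]
    ext j
    simp [Units.smul_def, Pi.single_apply]
  have hF : ZSpan.fundamentalDomain b
      =ᵐ[MeasureTheory.volume] Set.Icc (0 : ι → ℝ) (fun _ => 2 * Real.pi) := by
    have : ZSpan.fundamentalDomain b = Set.pi Set.univ fun _ => Set.Ico 0 (2 * Real.pi) := by
      ext x
      simp only [ZSpan.mem_fundamentalDomain, Set.mem_pi, Set.mem_univ, true_imp_iff]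
      refine forall_congr' fun i => ?_
      have : b.repr x i = (2 * Real.pi)⁻¹ * x i := by
        simp [b, Module.Basis.repr_unitsSMul, Units.smul_def]
      rw [this, Set.mem_Ico, Set.mem_Ico, inv_mul_lt_iff₀ hpi0, mul_one]
      exact and_congr_left fun _ => mul_nonneg_iff_of_pos_left (by positivity)
    rw [this]
    exact MeasureTheory.Measure.univ_pi_Ico_ae_eq_Icc
  have hper : ∀ (g : (Submodule.span ℤ (Set.range b)).toAddSubgroup) (x : ι → ℝ), φ.1 (g +ᵥ x) = φ.1 x := by
    rintro ⟨g, hg⟩ x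
    obtain ⟨k, rfl⟩ := (Submodule.mem_span_range_iff_exists_fun ℤ).1 hg
    rw [← φ.2.2 k x]
    refine congrArg φ.1 ?_
    change (∑ i, k i • b i) + x = _
    rw [add_comm]
    congr 1
    ext j
    simp [hb, Finset.sum_apply, Pi.single_apply, mul_comm]
  have h1 := ZSpan.isAddFundamentalDomain' b MeasureTheory.volume
  have : Countable (Submodule.span ℤ (Set.range b)).toAddSubgroup :=
    inferInstanceAs (Countable (Submodule.span ℤ (Set.range b)))
  have h2 := h1.vadd_of_comm v
  have h3 := h2.setIntegral_eq h1 hper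
  unfold torusIntegral
  rw [← MeasureTheory.setIntegral_congr_set hF, ← MeasureTheory.setIntegral_congr_set hF, ← h3]
  have h4 := (MeasureTheory.measurePreserving_add_right
    (MeasureTheory.volume : MeasureTheory.Measure (ι → ℝ)) v).setIntegral_preimage_emb
    (measurableEmbedding_addRight v) φ.1 (v +ᵥ ZSpan.fundamentalDomain b)
  rw [← h4]
  congr 2
  ext x
  simp [Set.mem_vadd_set_iff_neg_vadd_mem]

theorem torusIntegral_pderiv (φ : Smooth ι) (j : ι) : torusIntegral (pderiv j φ).1 = 0 := by
  have hc : Continuous (pderiv j φ).1 := (pderiv j φ).2.1.continuous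
  have hline : ∀ x : ι → ℝ, (∫ s in (0 : ℝ)..1, (pderiv j φ).1 (x + s • Pi.single j 1))
      = φ.1 (x + Pi.single j 1) - φ.1 x := fun x => by
    have hd : ∀ s : ℝ, HasDerivAt (fun s : ℝ => φ.1 (x + s • (Pi.single j 1 : ι → ℝ)))
        ((pderiv j φ).1 (x + s • Pi.single j 1)) s := fun s => by
      have h1 : HasDerivAt (fun s : ℝ => x + s • (Pi.single j 1 : ι → ℝ)) (Pi.single j 1) s := by
        simpa using ((hasDerivAt_id s).smul_const (Pi.single j 1 : ι → ℝ)).const_add x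
      exact (smooth_differentiable φ _).hasFDerivAt.comp_hasDerivAt s h1
    rw [intervalIntegral.integral_eq_sub_of_hasDerivAt (fun s _ => hd s)]
    · simp
    · exact (hc.comp (by fun_prop)).intervalIntegrable _ _
  have hcell : torusIntegral (fun x => ∫ s in (0 : ℝ)..1, (pderiv j φ).1 (x + s • Pi.single j 1))
      = 0 := by
    simp only [hline]
    have := torusIntegral_translate φ (Pi.single j 1)
    unfold torusIntegral at this ⊢
    rw [MeasureTheory.integral_sub, this, sub_self]
    · exact integrableOn_cell (φ.2.1.continuous.comp (by fun_prop))
    · exact integrableOn_cell φ.2.1.continuous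
  have hswap : torusIntegral
      (fun x => ∫ s in (0 : ℝ)..1, (pderiv j φ).1 (x + s • Pi.single j 1))
      = ∫ s in (0 : ℝ)..1, torusIntegral (fun x => (pderiv j φ).1 (x + s • Pi.single j 1)) := by
    unfold torusIntegral
    simp only [intervalIntegral.integral_of_le zero_le_one]
    refine MeasureTheory.integral_integral_swap ?_
    rw [MeasureTheory.Measure.prod_restrict]
    have hcont : Continuous (Function.uncurry fun (x : ι → ℝ) (s : ℝ) =>
        (pderiv j φ).1 (x + s • (Pi.single j 1 : ι → ℝ))) :=
      hc.comp (by fun_prop)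
    exact (hcont.continuousOn.integrableOn_compact
      (isCompact_Icc.prod (isCompact_Icc (a := (0 : ℝ)) (b := 1)))).mono_set
      (Set.prod_mono le_rfl Set.Ioc_subset_Icc_self)
  rw [hcell] at hswap
  simp only [torusIntegral_translate] at hswap
  simpa using hswap.symm

/-- The product of two smooth functions. -/
def smoothMul (f g : Smooth ι) : Smooth ι :=
  ⟨fun x => f.1 x * g.1 x, f.2.1.mul g.2.1, fun k x => by simp only [f.2.2 k x, g.2.2 k x]⟩

theorem pderiv_smoothMul (f g : Smooth ι) (j : ι) :
    pderiv j (smoothMul f g) = smoothMul (pderiv j f) g + smoothMul f (pderiv j g) := by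
  ext x
  change fderiv ℝ (fun x => f.1 x * g.1 x) x (Pi.single j 1) = _
  rw [fderiv_fun_mul (smooth_differentiable f x) (smooth_differentiable g x)]
  simp [smoothMul, pderiv]
  ring

theorem ofSmooth_char_pderiv (ν : ι → ℤ) (φ : Smooth ι) (j : ι) :
    (ofSmooth (char ν)).1 (pderiv j φ) = -(Complex.I * (ν j : ℂ)) * (ofSmooth (char ν)).1 φ := by
  have h := torusIntegral_pderiv (smoothMul (char ν) φ) j
  rw [pderiv_smoothMul, pderiv_char] at h
  have h2 : torusIntegral (smoothMul ((Complex.I * (ν j : ℂ)) • char ν) φ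
      + smoothMul (char ν) (pderiv j φ)).1
      = (Complex.I * (ν j : ℂ)) * (ofSmooth (char ν)).1 φ
        + (ofSmooth (char ν)).1 (pderiv j φ) := by
    change (∫ x in Set.Icc (0 : ι → ℝ) (fun _ => 2 * Real.pi),
      ((Complex.I * (ν j : ℂ)) * (char ν).1 x * φ.1 x + (char ν).1 x * (pderiv j φ).1 x)) = _
    rw [MeasureTheory.integral_add]
    · congr 1
      change _ = _ * ∫ x in Set.Icc (0 : ι → ℝ) (fun _ => 2 * Real.pi), (char ν).1 x * φ.1 x
      rw [← MeasureTheory.integral_const_mul]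
      simp only [mul_assoc]
    · exact integrableOn_cell
        ((continuous_const.mul (char ν).2.1.continuous).mul φ.2.1.continuous)
    · exact integrableOn_cell ((char ν).2.1.continuous.mul (pderiv j φ).2.1.continuous)
  rw [h2] at h
  linear_combination h

/-- The operator `1 - Δ`. -/
def oneSubLaplacian (φ : Smooth ι) : Smooth ι := φ - ∑ j, pderiv j (pderiv j φ)

theorem ofSmooth_char_oneSubLaplacian (ν : ι → ℤ) (φ : Smooth ι) :
    (ofSmooth (char ν)).1 (oneSubLaplacian φ) = (weight ν : ℂ) * (ofSmooth (char ν)).1 φ := by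
  simp only [oneSubLaplacian, map_sub, map_sum, ofSmooth_char_pderiv, weight]
  push_cast
  rw [add_mul, one_mul, Finset.sum_mul, sub_eq_add_neg, ← Finset.sum_neg_distrib]
  congr 1
  refine Finset.sum_congr rfl fun i _ => ?_
  linear_combination (-(ν i : ℂ) ^ 2 * (ofSmooth (char ν)).1 φ) * Complex.I_sq

theorem iterPderiv_add (w : List ι) (φ ψ : Smooth ι) :
    iterPderiv w (φ + ψ) = iterPderiv w φ + iterPderiv w ψ := by
  induction w with
  | nil => rfl
  | cons j w ih =>
    change pderiv j (iterPderiv w (φ + ψ)) = _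
    rw [ih, map_add]
    rfl

theorem DerivBound.add {k : ℕ} {M M' : ℝ} {φ ψ : Smooth ι} (h : DerivBound k M φ)
    (h' : DerivBound k M' ψ) : DerivBound k (M + M') (φ + ψ) := fun w hw x => by
  rw [iterPderiv_add]
  exact (norm_add_le _ _).trans (add_le_add (h w hw x) (h' w hw x))

theorem iterPderiv_smul (w : List ι) (c : ℂ) (φ : Smooth ι) :
    iterPderiv w (c • φ) = c • iterPderiv w φ := by
  induction w with
  | nil => rfl
  | cons j w ih =>
    change pderiv j (iterPderiv w (c • φ)) = _
    rw [ih, map_smul]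
    rfl

theorem DerivBound.neg {k : ℕ} {M : ℝ} {φ : Smooth ι} (h : DerivBound k M φ) :
    DerivBound k M (-φ) := fun w hw x => by
  rw [← neg_one_smul ℂ φ, iterPderiv_smul]
  change ‖(-1 : ℂ) * (iterPderiv w φ).1 x‖ ≤ M
  rw [norm_mul, norm_neg, norm_one, one_mul]
  exact h w hw x

theorem DerivBound.oneSubLaplacian {k : ℕ} {M : ℝ} {φ : Smooth ι} (h : DerivBound (k + 2) M φ) :
    DerivBound k ((1 + Fintype.card ι) * M) (oneSubLaplacian φ) := by
  have hs : ∀ s : Finset ι, DerivBound k (s.card * M) (∑ j ∈ s, ToroidalComplex.pderiv j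
      (ToroidalComplex.pderiv j φ)) := by
    intro s
    induction s using Finset.induction_on with
    | empty =>
      intro w _ x
      have : iterPderiv w (0 : Smooth ι) = 0 := by
        have := iterPderiv_smul w 0 (0 : Smooth ι)
        rwa [zero_smul, zero_smul] at this
      rw [Finset.sum_empty, this]
      simp
    | insert a s ha ih =>
      rw [Finset.sum_insert ha, Finset.card_insert_of_notMem ha]
      have := (((h.pderiv a).pderiv a)).add ih
      convert! this using 1
      push_cast
      ring
  have := (h.mono (k := k) (by omega)).add (hs Finset.univ).neg
  rw [ToroidalComplex.oneSubLaplacian, sub_eq_add_neg]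
  convert! this using 1
  rw [Finset.card_univ]
  ring

/-- The Fourier coefficients of a smooth function decay rapidly. -/
theorem norm_ofSmooth_char_le (m : ℕ) :
    ∃ C : ℝ, 0 ≤ C ∧ ∀ (φ : Smooth ι) (M : ℝ), DerivBound (2 * m) M φ → ∀ ν,
      ‖(ofSmooth (char ν)).1 φ‖ ≤ C * M * (weight ν ^ m)⁻¹ := by
  induction m with
  | zero =>
    refine ⟨MeasureTheory.volume.real (Set.Icc (0 : ι → ℝ) (fun _ => 2 * Real.pi)), by positivity,
      fun φ M h ν => ?_⟩
    have h1 : ∀ x, ‖(char ν).1 x * φ.1 x‖ ≤ M := fun x => by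
      have h1 : ‖(char ν).1 x‖ ≤ 1 := by
        have := derivBound_char ν 0 [] (by simp) x
        rwa [pow_zero] at this
      have h2 : ‖φ.1 x‖ ≤ M := h [] (by simp) x
      rw [norm_mul]
      nlinarith [norm_nonneg ((char ν).1 x), norm_nonneg (φ.1 x)]
    have := norm_torusIntegral_le h1
    simp only [pow_zero, inv_one, mul_one]
    rw [mul_comm]
    exact this
  | succ m ih =>
    obtain ⟨C, hC, H⟩ := ih
    refine ⟨C * (1 + Fintype.card ι), by positivity, fun φ M h ν => ?_⟩
    have h1 := H _ _ (DerivBound.oneSubLaplacian (k := 2 * m) h) ν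
    have hw : 0 < weight ν := by linarith [one_le_weight ν]
    rw [ofSmooth_char_oneSubLaplacian, norm_mul, Complex.norm_real, Real.norm_of_nonneg hw.le] at h1
    rw [pow_succ, mul_inv]
    calc ‖(ofSmooth (char ν)).1 φ‖
        = weight ν * ‖(ofSmooth (char ν)).1 φ‖ * (weight ν)⁻¹ := by field_simp
      _ ≤ C * ((1 + Fintype.card ι) * M) * (weight ν ^ m)⁻¹ * (weight ν)⁻¹ := by gcongr
      _ = _ := by ring

theorem summable_weight : Summable fun ν : ι → ℤ => (weight ν ^ Fintype.card ι)⁻¹ := by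
  have h1 : Summable fun n : ℤ => (1 + (n : ℝ) ^ 2)⁻¹ := by
    refine Summable.of_norm_bounded_eventually
      (Real.summable_one_div_int_pow.mpr (le_refl 2)) ?_
    rw [Filter.eventually_cofinite]
    refine (Set.finite_singleton (0 : ℤ)).subset fun n hn => ?_
    by_contra h0
    apply hn
    have h0' : (n : ℝ) ≠ 0 := by exact_mod_cast h0
    rw [Real.norm_of_nonneg (by positivity), one_div]
    gcongr
    linarith
  have hle : ∀ ν : ι → ℤ, (weight ν ^ Fintype.card ι)⁻¹ ≤ ∏ i, (1 + (ν i : ℝ) ^ 2)⁻¹ := fun ν => by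
    rw [Finset.prod_inv_distrib]
    refine inv_anti₀ (Finset.prod_pos fun i _ => by positivity) ?_
    rw [← Finset.card_univ]
    rw [← Finset.prod_const]
    refine Finset.prod_le_prod (fun i _ => by positivity) fun i _ => ?_
    unfold weight
    gcongr
    exact Finset.single_le_sum (f := fun i => (ν i : ℝ) ^ 2) (fun i _ => sq_nonneg _)
      (Finset.mem_univ i)
  have hnn : ∀ ν : ι → ℤ, 0 ≤ (weight ν ^ Fintype.card ι)⁻¹ := fun ν =>
    inv_nonneg.mpr (pow_nonneg (by linarith [one_le_weight ν]) _)
  refine summable_of_sum_le (c := ∏ _i : ι, ∑' n : ℤ, (1 + (n : ℝ) ^ 2)⁻¹) hnn fun s => ?_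
  let t : ι → Finset ℤ := fun i => s.image fun ν => ν i
  have hs : s ⊆ Fintype.piFinset t := fun ν hν => by
    rw [Fintype.mem_piFinset]
    exact fun i => Finset.mem_image_of_mem (fun ν : ι → ℤ => ν i) hν
  calc ∑ ν ∈ s, (weight ν ^ Fintype.card ι)⁻¹
      ≤ ∑ ν ∈ Fintype.piFinset t, (weight ν ^ Fintype.card ι)⁻¹ :=
        Finset.sum_le_sum_of_subset_of_nonneg hs fun ν _ _ => hnn ν
    _ ≤ ∑ ν ∈ Fintype.piFinset t, ∏ i, (1 + (ν i : ℝ) ^ 2)⁻¹ := Finset.sum_le_sum fun ν _ => hle ν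
    _ = ∏ i, ∑ n ∈ t i, (1 + (n : ℝ) ^ 2)⁻¹ :=
        (Finset.prod_univ_sum t fun _ n => (1 + (n : ℝ) ^ 2)⁻¹).symm
    _ ≤ _ := Finset.prod_le_prod (fun i _ => Finset.sum_nonneg fun n _ => by positivity)
        fun i _ => h1.sum_le_tsum _ fun n _ => by positivity

/-- At most polynomial growth of a function on `ℤ^ι`. -/
def PolyGrowth (σ : (ι → ℤ) → ℂ) : Prop :=
  ∃ (C : ℝ) (k : ℕ), ∀ ν, ‖σ ν‖ ≤ C * weight ν ^ k

theorem PolyGrowth.exists_bound {σ : (ι → ℤ) → ℂ} (hσ : PolyGrowth σ) (u : Distr ι) :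
    ∃ (k : ℕ) (C : ℝ), 0 ≤ C ∧ ∀ (φ : Smooth ι) (M : ℝ), DerivBound k M φ → ∀ ν,
      ‖σ ν * coeff u ν * (ofSmooth (char ν)).1 φ‖ ≤ C * M * (weight ν ^ Fintype.card ι)⁻¹ := by
  obtain ⟨A, a, hA⟩ := hσ
  obtain ⟨B, b, hB0, hB⟩ := exists_coeff_bound u
  obtain ⟨D, hD0, hD⟩ := norm_ofSmooth_char_le (ι := ι) (a + b + Fintype.card ι)
  refine ⟨2 * (a + b + Fintype.card ι), |A| * B * D, by positivity, fun φ M h ν => ?_⟩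
  have hw : 0 < weight ν := by linarith [one_le_weight ν]
  have hM := h.nonneg
  have h1 : ‖σ ν‖ ≤ |A| * weight ν ^ a :=
    (hA ν).trans (mul_le_mul_of_nonneg_right (le_abs_self A) (by positivity))
  rw [norm_mul, norm_mul]
  calc ‖σ ν‖ * ‖coeff u ν‖ * ‖(ofSmooth (char ν)).1 φ‖
      ≤ (|A| * weight ν ^ a) * (B * weight ν ^ b)
          * (D * M * (weight ν ^ (a + b + Fintype.card ι))⁻¹) := by
        gcongr
        · exact hB ν
        · exact hD φ M h ν
    _ = |A| * B * D * M * (weight ν ^ Fintype.card ι)⁻¹ := by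
        rw [pow_add, pow_add]
        field_simp

/-- Every smooth function has bounded derivatives. -/
theorem exists_derivBound (φ : Smooth ι) (k : ℕ) : ∃ M, DerivBound k M φ := by
  have hb : ∀ ψ : Smooth ι, ∃ B : ℝ, ∀ x, ‖ψ.1 x‖ ≤ B := fun ψ => by
    obtain ⟨B, hB⟩ := exists_bound ψ
    refine ⟨B, fun x => ?_⟩
    have hpi0 : 0 < 2 * Real.pi := by positivity
    rw [← ψ.2.2 (fun i => -⌊x i / (2 * Real.pi)⌋) x]
    refine hB _ ⟨fun i => ?_, fun i => ?_⟩
    · have := Int.floor_le (x i / (2 * Real.pi))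
      rw [le_div_iff₀ hpi0] at this
      simp only [Pi.zero_apply, Pi.add_apply]
      push_cast
      linarith
    · have := (Int.lt_floor_add_one (x i / (2 * Real.pi))).le
      rw [div_le_iff₀ hpi0] at this
      simp only [Pi.add_apply]
      push_cast
      linarith
  choose B hB using fun w : List ι => hb (iterPderiv w φ)
  obtain ⟨M, hM⟩ := ((List.finite_length_le ι k).image B).bddAbove
  exact ⟨M, fun w hw x => (hB w x).trans (hM ⟨w, hw, rfl⟩)⟩

theorem PolyGrowth.summable {σ : (ι → ℤ) → ℂ} (hσ : PolyGrowth σ) (u : Distr ι) (φ : Smooth ι) :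
    Summable fun ν => σ ν * coeff u ν * (ofSmooth (char ν)).1 φ := by
  obtain ⟨k, C, -, h⟩ := hσ.exists_bound u
  obtain ⟨M, hM⟩ := exists_derivBound φ k
  exact Summable.of_norm_bounded (summable_weight.mul_left (C * M)) (h φ M hM)

/-- The Fourier multiplier with symbol `σ`: `u ↦ ∑_ν σ(ν) û(ν) e^{iν·x}`, the series being
summed in `𝒟'(𝕋^ι)`, i.e. after pairing with a test function. -/
def multiplier (σ : (ι → ℤ) → ℂ) (hσ : PolyGrowth σ) : Distr ι →ₗ[ℂ] Distr ι where
  toFun u :=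
    ⟨{ toFun := fun φ => ∑' ν, σ ν * coeff u ν * (ofSmooth (char ν)).1 φ
       map_add' := fun φ ψ => by
         simp only [map_add, mul_add]
         exact (hσ.summable u φ).tsum_add (hσ.summable u ψ)
       map_smul' := fun c φ => by
         simp only [map_smul, smul_eq_mul, RingHom.id_apply]
         rw [← tsum_mul_left]
         exact tsum_congr fun ν => by ring }, by
      obtain ⟨k, C, hC, h⟩ := hσ.exists_bound u
      refine ⟨k, C * ∑' ν : ι → ℤ, (weight ν ^ Fintype.card ι)⁻¹, fun φ M hM => ?_⟩
      have := tsum_of_norm_bounded (summable_weight.mul_left (C * M)).hasSum (h φ M hM)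
      rw [tsum_mul_left] at this
      calc _ ≤ _ := this
        _ = _ := by ring⟩
  map_add' u v := by
    ext φ
    have : ∀ ν, coeff (u + v) ν = coeff u ν + coeff v ν := fun ν => by simp [coeff, mul_add]
    simp only [this, mul_add, add_mul]
    exact (hσ.summable u φ).tsum_add (hσ.summable v φ)
  map_smul' c u := by
    ext φ
    have : ∀ ν, coeff (c • u) ν = c * coeff u ν := fun ν => by
      simp [coeff]; ring
    simp only [this]
    change _ = c * ∑' ν, σ ν * coeff u ν * (ofSmooth (char ν)).1 φ
    rw [← tsum_mul_left]
    exact tsum_congr fun ν => by ring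

end Torus

/-! ### Toroidal symbols and the system `L_j = D_{t_j} + P_j(D_x)` -/

/-- `⟨ξ⟩ = (1 + |ξ|²)^{1/2}`. -/
def bracket {N : ℕ} (ξ : Fin N → ℤ) : ℝ := Real.sqrt (1 + ∑ i, (ξ i : ℝ) ^ 2)

/-- The iterated forward difference `Δ_{w₁} Δ_{w₂} ⋯ Δ_{w_r} a`, where
`Δ_j a (ξ) = a (ξ + e_j) - a ξ`. -/
def iterDiff {N : ℕ} (w : List (Fin N)) (a : (Fin N → ℤ) → ℂ) : (Fin N → ℤ) → ℂ :=
  w.foldr (fun j b => fwdDiff (Pi.single j 1) b) a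

/-- The (`x`-independent) toroidal symbol class `S^m(ℤ^N)`:
`|Δ^α a(ξ)| ≤ C_α ⟨ξ⟩^{m - |α|}` for every `α`. -/
structure ToroidalSymbol (N : ℕ) (m : ℝ) where
  toFun : (Fin N → ℤ) → ℂ
  bound : ∀ w : List (Fin N), ∃ C : ℝ, ∀ ξ, ‖iterDiff w toFun ξ‖ ≤ C * bracket ξ ^ (m - w.length)

section System

variable {n N : ℕ}

theorem ToroidalSymbol.polyGrowth {m : ℝ} (a : ToroidalSymbol N m) :
    PolyGrowth fun ν : Fin n ⊕ Fin N → ℤ => a.toFun fun i => ν (Sum.inr i) := by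
  obtain ⟨C, hC⟩ := a.bound []
  refine ⟨|C|, ⌈|m|⌉₊, fun ν => ?_⟩
  have h1 := hC fun i => ν (Sum.inr i)
  simp only [iterDiff, List.foldr_nil, List.length_nil, Nat.cast_zero, sub_zero] at h1
  have hs : 0 ≤ ∑ i, (ν (Sum.inr i : Fin n ⊕ Fin N) : ℝ) ^ 2 :=
    Finset.sum_nonneg fun i _ => sq_nonneg _
  have hb1 : 1 ≤ bracket fun i => ν (Sum.inr i) := by
    unfold bracket
    rw [Real.one_le_sqrt]
    linarith
  have hb2 : (bracket fun i => ν (Sum.inr i)) ≤ weight ν := by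
    unfold bracket
    rw [Real.sqrt_le_left (by linarith [one_le_weight ν])]
    have h3 : 1 + ∑ i, (ν (Sum.inr i : Fin n ⊕ Fin N) : ℝ) ^ 2 ≤ weight ν := by
      unfold weight
      rw [Fintype.sum_sum_type]
      have : 0 ≤ ∑ i, (ν (Sum.inl i : Fin n ⊕ Fin N) : ℝ) ^ 2 :=
        Finset.sum_nonneg fun i _ => sq_nonneg _
      linarith
    nlinarith [one_le_weight ν]
  calc ‖a.toFun fun i => ν (Sum.inr i)‖ ≤ C * (bracket fun i => ν (Sum.inr i)) ^ m := h1
    _ ≤ |C| * (bracket fun i => ν (Sum.inr i)) ^ (⌈|m|⌉₊ : ℝ) := by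
      refine mul_le_mul (le_abs_self C) ?_ (by positivity) (abs_nonneg C)
      exact Real.rpow_le_rpow_of_exponent_le hb1 ((le_abs_self m).trans (Nat.le_ceil _))
    _ ≤ |C| * weight ν ^ ⌈|m|⌉₊ := by
      rw [Real.rpow_natCast]
      gcongr

/-- The operator `P(D_x)` with toroidal symbol `a ∈ S^m(ℤ^N)`, acting on distributions on
`𝕋^{n+N} = 𝕋^n_t × 𝕋^N_x`: the mode `e^{i(η·t + ξ·x)}` is multiplied by `a(ξ)`. -/
def pseudoDiff {m : ℝ} (a : ToroidalSymbol N m) :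
    Distr (Fin n ⊕ Fin N) →ₗ[ℂ] Distr (Fin n ⊕ Fin N) :=
  multiplier (fun ν => a.toFun fun i => ν (Sum.inr i)) a.polyGrowth

/-- `L_j = D_{t_j} + P_j(D_x)`, with `D_{t_j} = -i ∂_{t_j}`. -/
def opL {m : Fin n → ℝ} (P : ∀ j, ToroidalSymbol N (m j)) (j : Fin n) :
    Distr (Fin n ⊕ Fin N) →ₗ[ℂ] Distr (Fin n ⊕ Fin N) :=
  (-Complex.I) • Distr.pderiv (Sum.inl j) + pseudoDiff (P j)

/-! ### Forms in the variables `t` and the complex -/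

/-- A `p`-form `∑_{|K| = p} u_K dt_K` with coefficients `u_K` in `A`, where
`dt_K = dt_{k₁} ∧ ⋯ ∧ dt_{k_p}` for `K = {k₁ < ⋯ < k_p} ⊆ {1, …, n}`. -/
abbrev Form (n p : ℕ) (A : Type) : Type := {K : Finset (Fin n) // K.card = p} → A

/-- The coefficient of `dt_J` in `dt_j ∧ dt_K`. -/
def wedgeSign (j : Fin n) (K J : Finset (Fin n)) : ℤ :=
  if j ∉ K ∧ J = insert j K then (-1) ^ (K.filter (· < j)).card else 0

/-- The map `∑_K u_K dt_K ↦ ∑_j ∑_K (T_j u_K) dt_j ∧ dt_K`. -/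
def wedgeOp {A : Type} [AddCommGroup A] (T : Fin n → A → A) {p : ℕ} (u : Form n p A) :
    Form n (p + 1) A :=
  fun J => ∑ j, ∑ K, wedgeSign j K.1 J.1 • T j (u K)

/-- The operator `𝕃^p u = ∑_j ∑_{|K| = p} (i L_j u_K) dt_j ∧ dt_K` on `p`-currents. -/
def opLL {m : Fin n → ℝ} (P : ∀ j, ToroidalSymbol N (m j)) (p : ℕ)
    (u : Form n p (Distr (Fin n ⊕ Fin N))) : Form n (p + 1) (Distr (Fin n ⊕ Fin N)) :=
  wedgeOp (fun j v => Complex.I • opL P j v) u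

/-- The exterior derivative `d_t` on smooth `p`-forms on `𝕋^n_t`. -/
def torusExtDeriv {p : ℕ} (g : Form n p (Smooth (Fin n))) : Form n (p + 1) (Smooth (Fin n)) :=
  wedgeOp (fun j v => pderiv j v) g

/-- The `(p+1)`-form `∑_J h_J dt_J` is `d_t` of a smooth `p`-form on `𝕋^n_t`. -/
def IsExactForm {p : ℕ} (h : Form n (p + 1) ((Fin n → ℝ) → ℂ)) : Prop :=
  ∃ g : Form n p (Smooth (Fin n)), ∀ J t, h J t = (torusExtDeriv g J).1 t

/-- The partial Fourier coefficient `f̂(t, ξ) = (2π)^{-N} ∫_{𝕋^N} e^{-iξ·x} f(t, x) dx`. -/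
def partialCoeff (f : Smooth (Fin n ⊕ Fin N)) (ξ : Fin N → ℤ) (t : Fin n → ℝ) : ℂ :=
  ((2 * Real.pi : ℝ) : ℂ)⁻¹ ^ N *
    torusIntegral fun x : Fin N → ℝ =>
      Complex.exp (-Complex.I * ((∑ i, (ξ i : ℝ) * x i : ℝ) : ℂ)) * f.1 (Sum.elim t x)

/-- The constant `1`-form `∑_j c_j dt_j` on `𝕋^n` is integral: it is real and its integral over
each closed curve `γ` in `𝕋^n`, given by a lift to `ℝ^n`, is in `2πℤ`. -/
def IsIntegralForm (c : Fin n → ℂ) : Prop :=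
  (∀ j, (c j).im = 0) ∧
    ∀ γ : ℝ → Fin n → ℝ, ContDiff ℝ 1 γ →
      (∃ k : Fin n → ℤ, γ 1 = γ 0 + fun j => 2 * Real.pi * (k j : ℝ)) →
      ∃ l : ℤ, (1 / (2 * Real.pi)) * ∫ s in (0 : ℝ)..1, ∑ j, (c j).re * deriv γ s j = l

/-- The real function `ψ ∈ C^∞(ℝ^n)` is a primitive of (the pull-back to `ℝ^n` of) the constant
`1`-form `∑_j c_j dt_j`. -/
def IsPrimitive (ψ : (Fin n → ℝ) → ℝ) (c : Fin n → ℂ) : Prop :=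
  ContDiff ℝ ∞ ψ ∧ ∀ t v, ((fderiv ℝ ψ t v : ℝ) : ℂ) = ∑ j, c j * (v j : ℂ)

/-- The compatibility set `𝔼^p`: the smooth `(p+1)`-forms `f` with `𝕃^{p+1} f = 0` such that
`f̂(t, ξ) e^{iψ_ξ(t)}` is exact whenever `c_{ξ0} = ∑_j p_j(ξ) dt_j` is integral, where
`dψ_ξ = c_{ξ0}` on `ℝ^n`. -/
def compatSet {m : Fin n → ℝ} (P : ∀ j, ToroidalSymbol N (m j)) (p : ℕ) :
    Set (Form n (p + 1) (Smooth (Fin n ⊕ Fin N))) :=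
  {f | opLL P (p + 1) (fun J => ofSmooth (f J)) = 0 ∧
    ∀ ξ : Fin N → ℤ, IsIntegralForm (fun j => (P j).toFun ξ) →
      ∀ ψ : (Fin n → ℝ) → ℝ, IsPrimitive ψ (fun j => (P j).toFun ξ) →
        IsExactForm fun J t => partialCoeff (f J) ξ t * Complex.exp (Complex.I * (ψ t : ℂ))}

/-- `𝕃^p` is globally solvable on `𝕋^{n+N}`. -/
def GloballySolvable {m : Fin n → ℝ} (P : ∀ j, ToroidalSymbol N (m j)) (p : ℕ) : Prop :=
  ∀ f ∈ compatSet P p, ∃ u : Form n p (Distr (Fin n ⊕ Fin N)),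
    opLL P p u = fun J => ofSmooth (f J)

/-- The coefficients `i(η_j + p_j(ξ))` of the symbol `∑_j i(η_j + p_j(ξ)) dt_j` of `𝕃^p`. Its
norm as an element of `Fin n → ℂ` is `max_j |η_j + p_j(ξ)|`. -/
def symbolLL {m : Fin n → ℝ} (P : ∀ j, ToroidalSymbol N (m j)) (η : Fin n → ℤ) (ξ : Fin N → ℤ) :
    Fin n → ℂ :=
  fun j => Complex.I * ((η j : ℂ) + (P j).toFun ξ)

/-- The Euclidean norm `|(η, ξ)|`. -/
def freqNorm (η : Fin n → ℤ) (ξ : Fin N → ℤ) : ℝ :=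
  Real.sqrt (∑ j, (η j : ℝ) ^ 2 + ∑ i, (ξ i : ℝ) ^ 2)

end System

end ToroidalComplex

end

/-!
The proof is a Fourier series argument. On the mode `ν = (η, ξ)` the operator `i L_j` is the
multiplication by `a_j(ν) = i (η_j + p_j(ξ))`, so `𝕃^p` becomes the exterior product with the
covector `a(ν)` (`coeff_opLL`), i.e. the Koszul complex of `a(ν)`. Fourier inversion for smooth
functions comes from Mathlib's theorem on `UnitAddTorus`; it gives that distributions are determined
by their coefficients (`Distr.ext_coeff`), and rapidly decaying coefficients define smooth functions
(`ofCoeff`). The lower bound on the symbol says that `‖a(ν)‖⁻¹` grows at most polynomially where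
`a(ν) ≠ 0` (`smallDivisorBound_iff`).

If this holds, a compatible `f` is solved frequency by frequency. Where `a(ν) ≠ 0`, contracting
`f̂(ν)` with the vector `τ = ā / ∑ |a_j|²` gives a primitive by Cartan's identity
(`wedgeForm_contractForm`), and `τ` is a multiplier of polynomial growth. Where `a(ν) = 0`, the form
`∑_j p_j(ξ) dt_j = -∑_j η_j dt_j` is integral, and the exactness of `f̂(t, ξ) e^{-iη·t}` says that
its mean `f̂(ν)` vanishes (`coeff_eq_zero_of_mem_compatSet`).

If it fails, there are frequencies `ν_k` with `0 < ‖a(ν_k)‖ < ((k + 1) (1 + |ν_k|²)^k)⁻¹`. Take `f`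
with coefficients `‖a‖^{-1/2} a ∧ dt_K` at these frequencies and zero elsewhere, where `K` is a
`p`-subset avoiding an index at which `|a_j|` is maximal; such `K` exists because `p < n`. The
coefficients have size about `‖a‖^{1/2}`, so `f` is smooth, and it is `𝕃`-closed. For integral `ξ`
the symbol has values in `iℤ^n`, so it cannot be small without vanishing, hence `f̂(·, ξ) = 0` and `f`
is compatible. But `a ∧ û = f̂` forces `û(ν_k)` to be at least of size `‖a(ν_k)‖^{-1/2}`, which is
not of polynomial growth, so no distribution `u` solves `𝕃^p u = f`.
-/

noncomputable section

namespace ToroidalComplex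

/-! ### Fourier series of smooth functions on the torus -/

section Fourier

variable {ι : Type} [Fintype ι]

theorem char_zero_apply (x : ι → ℝ) : (char (0 : ι → ℤ)).1 x = 1 := by simp [char]

theorem char_add_apply (μ ν : ι → ℤ) (x : ι → ℝ) :
    (char (μ + ν)).1 x = (char μ).1 x * (char ν).1 x := by
  simp only [char, ← Complex.exp_add]
  congr 1
  rw [← mul_add, ← Complex.ofReal_add, ← Finset.sum_add_distrib]
  congr 2
  exact Finset.sum_congr rfl fun i _ => by push_cast [Pi.add_apply]; ring

theorem norm_char_apply (ν : ι → ℤ) (x : ι → ℝ) : ‖(char ν).1 x‖ = 1 := by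
  simp only [char]
  rw [mul_comm]
  exact Complex.norm_exp_ofReal_mul_I _

/-- A smooth function descends, after rescaling the period to `1`, to Mathlib's torus. -/
theorem exists_continuousMap_unitAddTorus (f : Smooth ι) :
    ∃ F : C(UnitAddTorus ι, ℂ), ∀ y : ι → ℝ,
      F (fun i => (y i : UnitAddCircle)) = f.1 ((2 * Real.pi) • y) := by
  have hq : IsOpenQuotientMap fun (y : ι → ℝ) (i : ι) => (y i : UnitAddCircle) :=
    IsOpenQuotientMap.piMap fun _ => QuotientAddGroup.isOpenQuotientMap_mk
  have hper : ∀ y z : ι → ℝ, (fun i => (y i : UnitAddCircle)) = (fun i => (z i : UnitAddCircle)) →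
      f.1 ((2 * Real.pi) • y) = f.1 ((2 * Real.pi) • z) := by
    intro y z h
    have h1 : ∀ i, ∃ k : ℤ, y i = z i + k := fun i => by
      have := congrFun h i
      obtain ⟨k, hk⟩ := QuotientAddGroup.eq_iff_sub_mem.1 this
      refine ⟨k, ?_⟩
      simp only [zsmul_eq_mul, mul_one] at hk
      linarith
    choose k hk using h1
    rw [← f.2.2 k ((2 * Real.pi) • z)]
    refine congrArg f.1 (funext fun i => ?_)
    simp [hk, mul_add]
  let F : UnitAddTorus ι → ℂ := fun z => f.1 ((2 * Real.pi) • Function.surjInv hq.surjective z)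
  have hF : ∀ y : ι → ℝ, F (fun i => (y i : UnitAddCircle)) = f.1 ((2 * Real.pi) • y) := fun y =>
    hper _ _ (Function.surjInv_eq hq.surjective _)
  refine ⟨⟨F, ?_⟩, hF⟩
  rw [hq.isQuotientMap.continuous_iff]
  have : F ∘ (fun (y : ι → ℝ) (i : ι) => (y i : UnitAddCircle))
      = fun y => f.1 ((2 * Real.pi) • y) := funext hF
  rw [this]
  exact f.2.1.continuous.comp (by fun_prop)

theorem mFourier_coe (ν : ι → ℤ) (y : ι → ℝ) :
    UnitAddTorus.mFourier ν (fun i => (y i : UnitAddCircle)) = (char ν).1 ((2 * Real.pi) • y) := by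
  simp only [UnitAddTorus.mFourier, ContinuousMap.coe_mk, fourier_coe_apply, char,
    ← Complex.exp_sum]
  congr 1
  push_cast
  rw [Finset.mul_sum]
  exact Finset.sum_congr rfl fun i _ => by simp; ring

variable [DecidableEq ι]

theorem torusIntegral_char (ν : ι → ℤ) :
    torusIntegral (char ν).1
      = if ν = 0 then ((2 * Real.pi : ℝ) : ℂ) ^ Fintype.card ι else 0 := by
  split_ifs with h
  · subst h
    simp only [torusIntegral, char_zero_apply]
    rw [MeasureTheory.setIntegral_const, MeasureTheory.measureReal_def, Real.volume_Icc_pi]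
    simp [ENNReal.toReal_mul, Real.pi_nonneg]
  · obtain ⟨j, hj⟩ := Function.ne_iff.1 h
    have h1 := torusIntegral_pderiv (char ν) j
    rw [pderiv_char] at h1
    have h2 : torusIntegral ((Complex.I * (ν j : ℂ)) • char ν).1
        = (Complex.I * (ν j : ℂ)) * torusIntegral (char ν).1 :=
      MeasureTheory.integral_const_mul _ _
    rw [h2] at h1
    have hj' : (ν j : ℂ) ≠ 0 := by exact_mod_cast hj
    simpa [hj'] using h1

theorem ofSmooth_apply (f φ : Smooth ι) :
    (ofSmooth f).1 φ = torusIntegral fun x => f.1 x * φ.1 x := rfl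

theorem ofSmooth_char_char (μ ν : ι → ℤ) :
    (ofSmooth (char μ)).1 (char ν)
      = if μ + ν = 0 then ((2 * Real.pi : ℝ) : ℂ) ^ Fintype.card ι else 0 := by
  rw [ofSmooth_apply, ← torusIntegral_char]
  exact congrArg torusIntegral (funext fun x => (char_add_apply μ ν x).symm)

theorem coeff_ofSmooth (f : Smooth ι) (ν : ι → ℤ) :
    coeff (ofSmooth f) ν
      = ((2 * Real.pi : ℝ) : ℂ)⁻¹ ^ Fintype.card ι * (ofSmooth (char (-ν))).1 f := by
  simp only [coeff, ofSmooth_apply, mul_comm]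

/-- Rapid decay of a function on `ℤ^ι`: it decays faster than every power of the weight. -/
def RapidDecay (c : (ι → ℤ) → ℂ) : Prop :=
  ∀ m : ℕ, ∃ C : ℝ, ∀ ν, ‖c ν‖ * weight ν ^ m ≤ C

theorem RapidDecay.summable_mul_weight_pow {c : (ι → ℤ) → ℂ} (hc : RapidDecay c) (m : ℕ) :
    Summable fun ν => ‖c ν‖ * weight ν ^ m := by
  obtain ⟨C, hC⟩ := hc (m + Fintype.card ι)
  refine Summable.of_nonneg_of_le (fun ν => ?_) (fun ν => ?_) (summable_weight.mul_left C)
  · have := one_le_weight ν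
    positivity
  · have hw : 0 < weight ν := by linarith [one_le_weight ν]
    rw [← div_eq_mul_inv, le_div_iff₀ (by positivity), mul_assoc, ← pow_add]
    exact hC ν

theorem RapidDecay.summable_norm {c : (ι → ℤ) → ℂ} (hc : RapidDecay c) :
    Summable fun ν => ‖c ν‖ := by
  simpa using hc.summable_mul_weight_pow 0

theorem rapidDecay_coeff_ofSmooth (f : Smooth ι) : RapidDecay (coeff (ofSmooth f)) := fun m => by
  obtain ⟨C, hC, H⟩ := norm_ofSmooth_char_le (ι := ι) m
  obtain ⟨M, hM⟩ := exists_derivBound f (2 * m)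
  refine ⟨‖((2 * Real.pi : ℝ) : ℂ)⁻¹ ^ Fintype.card ι‖ * (C * M), fun ν => ?_⟩
  have hw : 0 < weight ν := by linarith [one_le_weight ν]
  rw [coeff_ofSmooth, norm_mul, mul_assoc]
  refine mul_le_mul_of_nonneg_left ?_ (norm_nonneg _)
  have := H f M hM (-ν)
  rwa [weight_neg, ← div_eq_mul_inv, le_div_iff₀ (by positivity)] at this

open scoped Pointwise in
/-- Fourier inversion for smooth functions. -/
theorem hasSum_coeff_ofSmooth_mul_char (f : Smooth ι) (x : ι → ℝ) :
    HasSum (fun ν => coeff (ofSmooth f) ν * (char ν).1 x) (f.1 x) := by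
  obtain ⟨F, hF⟩ := exists_continuousMap_unitAddTorus f
  have hpi : 0 < 2 * Real.pi := by positivity
  have hcube : (2 * Real.pi) • Set.Icc (0 : ι → ℝ) (fun _ => 1)
      = Set.Icc (0 : ι → ℝ) (fun _ => 2 * Real.pi) := by
    ext y
    rw [Set.mem_smul_set_iff_inv_smul_mem₀ hpi.ne']
    simp only [Set.mem_Icc, Pi.le_def, Pi.smul_apply, smul_eq_mul, Pi.zero_apply,
      inv_mul_le_iff₀ hpi, mul_one]
    exact and_congr_left fun _ => forall_congr' fun i =>
      mul_nonneg_iff_of_pos_left (inv_pos.2 hpi)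
  have hcoeff : ∀ ν, UnitAddTorus.mFourierCoeff F ν = coeff (ofSmooth f) ν := fun ν => by
    rw [UnitAddTorus.mFourierCoeff_eq_integral F ν 0, coeff_ofSmooth, ofSmooth_apply]
    have h1 : ({x : ι → ℝ | ∀ i, x i ∈ Set.Ioc ((0 : ι → ℝ) i) ((0 : ι → ℝ) i + 1)})
        =ᵐ[MeasureTheory.volume] Set.Icc (0 : ι → ℝ) (fun _ => 1) := by
      have : ({x : ι → ℝ | ∀ i, x i ∈ Set.Ioc ((0 : ι → ℝ) i) ((0 : ι → ℝ) i + 1)})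
          = Set.pi Set.univ fun _ => Set.Ioc 0 1 := by ext; simp
      rw [this]
      exact MeasureTheory.Measure.univ_pi_Ioc_ae_eq_Icc
    rw [MeasureTheory.setIntegral_congr_set h1]
    simp only [mFourier_coe, hF, smul_eq_mul]
    rw [MeasureTheory.Measure.setIntegral_comp_smul_of_pos MeasureTheory.volume
      (fun x => (char (-ν)).1 x * f.1 x) _ hpi, hcube, Module.finrank_fintype_fun_eq_card, torusIntegral, Complex.real_smul]
    push_cast
    rw [inv_pow]
  have hs : Summable (UnitAddTorus.mFourierCoeff F) := by
    rw [funext hcoeff]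
    exact (rapidDecay_coeff_ofSmooth f).summable_norm.of_norm
  have := UnitAddTorus.hasSum_mFourier_series_apply_of_summable hs
    (fun i => (((2 * Real.pi)⁻¹ • x) i : UnitAddCircle))
  simpa only [hcoeff, mFourier_coe, hF, smul_inv_smul₀ hpi.ne', smul_eq_mul] using this

end Fourier

section Fourier

variable {ι : Type} [Fintype ι]

theorem hasSum_torusIntegral {κ : Type} [Countable κ] {F : κ → (ι → ℝ) → ℂ} {f : (ι → ℝ) → ℂ}
    {B : κ → ℝ} (hF : ∀ ν, Continuous (F ν)) (hB : ∀ ν x, ‖F ν x‖ ≤ B ν) (hs : Summable B)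
    (h : ∀ x, HasSum (fun ν => F ν x) (f x)) :
    HasSum (fun ν => torusIntegral (F ν)) (torusIntegral f) := by
  refine MeasureTheory.hasSum_integral_of_dominated_convergence (fun ν _ => B ν)
    (fun ν => (hF ν).aestronglyMeasurable) (fun ν => Filter.Eventually.of_forall (hB ν))
    (Filter.Eventually.of_forall fun _ => hs) ?_ (Filter.Eventually.of_forall h)
  exact MeasureTheory.integrableOn_const isCompact_Icc.measure_lt_top.ne

theorem iteratedDeriv_cexp_I_mul (k : ℕ) :
    iteratedDeriv k (fun s : ℝ => Complex.exp (Complex.I * s))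
      = fun s : ℝ => Complex.I ^ k * Complex.exp (Complex.I * s) := by
  induction k with
  | zero => simp
  | succ k ih =>
    rw [iteratedDeriv_succ, ih]
    ext s
    have h : HasDerivAt (fun s : ℝ => Complex.I * (s : ℂ)) Complex.I s := by
      simpa using (Complex.ofRealCLM.hasDerivAt (x := s)).const_mul Complex.I
    rw [(h.cexp.const_mul _).deriv]
    ring

theorem norm_iteratedFDeriv_char_le (ν : ι → ℤ) (k : ℕ) (x : ι → ℝ) :
    ‖iteratedFDeriv ℝ k (char ν).1 x‖ ≤ (Fintype.card ι * weight ν) ^ k := by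
  classical
  let L : (ι → ℝ) →L[ℝ] ℝ := ∑ i, (ν i : ℝ) • ContinuousLinearMap.proj (R := ℝ) i
  have hL : ‖L‖ ≤ Fintype.card ι * weight ν := by
    have hw := one_le_weight ν
    refine L.opNorm_le_bound (by positivity) fun y => ?_
    have : L y = ∑ i, (ν i : ℝ) * y i := by simp [L]
    rw [this]
    calc ‖∑ i, (ν i : ℝ) * y i‖ ≤ ∑ _i : ι, weight ν * ‖y‖ := by
          refine norm_sum_le_of_le _ fun i _ => ?_
          rw [norm_mul]
          exact mul_le_mul (abs_le_weight ν i) (norm_le_pi_norm y i) (norm_nonneg _) (by linarith)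
      _ = _ := by simp [mul_assoc]
  have hf : ContDiff ℝ ∞ (fun s : ℝ => Complex.exp (Complex.I * s)) :=
    (contDiff_const.mul Complex.ofRealCLM.contDiff).cexp
  have hc : (char ν).1 = (fun s : ℝ => Complex.exp (Complex.I * s)) ∘ L := by
    ext y
    simp [char, L]
  rw [hc, L.iteratedFDeriv_comp_right hf x (by exact_mod_cast le_top)]
  refine (ContinuousMultilinearMap.norm_compContinuousLinearMap_le _ _).trans ?_
  rw [norm_iteratedFDeriv_eq_norm_iteratedDeriv, iteratedDeriv_cexp_I_mul]
  have : ‖Complex.exp (Complex.I * (L x : ℂ))‖ = 1 := by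
    rw [mul_comm]
    exact Complex.norm_exp_ofReal_mul_I _
  rw [norm_mul, this, norm_pow, Complex.norm_I]
  simp only [one_pow, one_mul, Finset.prod_const, Finset.card_univ, Fintype.card_fin]
  exact pow_le_pow_left₀ (norm_nonneg _) hL k

variable [DecidableEq ι]

/-- The smooth function `∑_ν c(ν) e^{iν·x}` with rapidly decaying Fourier coefficients `c`. -/
def ofCoeff (c : (ι → ℤ) → ℂ) (hc : RapidDecay c) : Smooth ι :=
  ⟨fun x => ∑' ν, c ν * (char ν).1 x, by
    refine ⟨?_, fun k x => ?_⟩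
    · refine contDiff_tsum (v := fun k ν => (Fintype.card ι : ℝ) ^ k * (‖c ν‖ * weight ν ^ k))
        (fun ν => contDiff_const.mul (char ν).2.1)
        (fun k _ => (hc.summable_mul_weight_pow k).mul_left _) fun k ν x _ => ?_
      have h1 : iteratedFDeriv ℝ k (fun x => c ν * (char ν).1 x) x
          = c ν • iteratedFDeriv ℝ k (char ν).1 x :=
        iteratedFDeriv_const_smul_apply (a := c ν) (f := (char ν).1)
          ((char ν).2.1.contDiffAt.of_le (by exact_mod_cast le_top))
      rw [h1, norm_smul]
      calc ‖c ν‖ * ‖iteratedFDeriv ℝ k (char ν).1 x‖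
          ≤ ‖c ν‖ * (Fintype.card ι * weight ν) ^ k :=
            mul_le_mul_of_nonneg_left (norm_iteratedFDeriv_char_le ν k x) (norm_nonneg _)
        _ = _ := by ring
    · exact tsum_congr fun ν => by rw [(char ν).2.2 k x]⟩

theorem hasSum_ofCoeff {c : (ι → ℤ) → ℂ} (hc : RapidDecay c) (x : ι → ℝ) :
    HasSum (fun ν => c ν * (char ν).1 x) ((ofCoeff c hc).1 x) :=
  (Summable.of_norm (by simpa [norm_char_apply] using hc.summable_norm)).hasSum

theorem coeff_ofSmooth_ofCoeff {c : (ι → ℤ) → ℂ} (hc : RapidDecay c) (ν : ι → ℤ) :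
    coeff (ofSmooth (ofCoeff c hc)) ν = c ν := by
  have h1 : HasSum (fun μ => torusIntegral fun x => c μ * (char μ).1 x * (char (-ν)).1 x)
      (torusIntegral fun x => (ofCoeff c hc).1 x * (char (-ν)).1 x) := by
    refine hasSum_torusIntegral (B := fun μ => ‖c μ‖) (fun μ => ?_) (fun μ x => ?_)
      hc.summable_norm fun x => (hasSum_ofCoeff hc x).mul_right _
    · exact (continuous_const.mul (char μ).2.1.continuous).mul (char (-ν)).2.1.continuous
    · simp [norm_char_apply]
  have h2 : ∀ μ, (torusIntegral fun x => c μ * (char μ).1 x * (char (-ν)).1 x)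
      = if μ = ν then c ν * ((2 * Real.pi : ℝ) : ℂ) ^ Fintype.card ι else 0 := fun μ => by
    have h3 : (torusIntegral fun x => c μ * (char μ).1 x * (char (-ν)).1 x)
        = c μ * (ofSmooth (char μ)).1 (char (-ν)) := by
      rw [ofSmooth_apply]
      simp only [mul_assoc]
      exact MeasureTheory.integral_const_mul _ _
    rw [h3, ofSmooth_char_char]
    by_cases h : μ = ν <;> simp [h, ← sub_eq_add_neg, sub_eq_zero]
  simp only [h2] at h1
  have h4 := h1.unique (hasSum_ite_eq ν _)
  have hpi : ((2 * Real.pi : ℝ) : ℂ) ≠ 0 := by exact_mod_cast (by positivity : 2 * Real.pi ≠ 0)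
  rw [coeff, ofSmooth_apply, h4, mul_left_comm, ← mul_pow, inv_mul_cancel₀ hpi, one_pow, mul_one]

/-! ### Fourier coefficients determine a distribution -/

/-- The `ν`-th Fourier coefficient as a linear functional on distributions. -/
def coeffHom (ν : ι → ℤ) : Distr ι →ₗ[ℂ] ℂ where
  toFun u := coeff u ν
  map_add' u v := by simp [coeff, mul_add]
  map_smul' c u := by simp [coeff]; ring

theorem coeffHom_apply (ν : ι → ℤ) (u : Distr ι) : coeffHom ν u = coeff u ν := rfl

theorem coeff_distr_pderiv (u : Distr ι) (j : ι) (ν : ι → ℤ) :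
    coeff (Distr.pderiv j u) ν = Complex.I * (ν j : ℂ) * coeff u ν := by
  have h : (Distr.pderiv j u).1 (char (-ν)) = -(u.1 (pderiv j (char (-ν)))) := rfl
  rw [coeff, coeff, h, pderiv_char, map_smul]
  simp only [Pi.neg_apply, Int.cast_neg, smul_eq_mul]
  ring

theorem coeff_multiplier (σ : (ι → ℤ) → ℂ) (hσ : PolyGrowth σ) (u : Distr ι) (ν : ι → ℤ) :
    coeff (multiplier σ hσ u) ν = σ ν * coeff u ν := by
  have hpi : ((2 * Real.pi : ℝ) : ℂ) ≠ 0 := by exact_mod_cast (by positivity : 2 * Real.pi ≠ 0)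
  have h : (multiplier σ hσ u).1 (char (-ν))
      = ∑' μ, σ μ * coeff u μ * (ofSmooth (char μ)).1 (char (-ν)) := rfl
  rw [coeff, h, tsum_eq_single ν]
  · rw [ofSmooth_char_char, if_pos (add_neg_cancel ν), mul_left_comm, ← mul_pow,
      inv_mul_cancel₀ hpi, one_pow, mul_one]
  · intro μ hμ
    rw [ofSmooth_char_char, if_neg (by rwa [← sub_eq_add_neg, sub_eq_zero]), mul_zero]

theorem coeff_ofSmooth_pderiv (f : Smooth ι) (j : ι) (ν : ι → ℤ) :
    coeff (ofSmooth (pderiv j f)) ν = Complex.I * (ν j : ℂ) * coeff (ofSmooth f) ν := by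
  rw [coeff_ofSmooth, coeff_ofSmooth, ofSmooth_char_pderiv]
  simp only [Pi.neg_apply, Int.cast_neg]
  ring

theorem norm_coeff_ofSmooth_iterPderiv_le (f : Smooth ι) (w : List ι) (ν : ι → ℤ) :
    ‖coeff (ofSmooth (iterPderiv w f)) ν‖ ≤ ‖coeff (ofSmooth f) ν‖ * weight ν ^ w.length := by
  have hw := one_le_weight ν
  induction w with
  | nil => simp [iterPderiv]
  | cons j w ih =>
    change ‖coeff (ofSmooth (pderiv j (iterPderiv w f))) ν‖ ≤ _
    rw [coeff_ofSmooth_pderiv, norm_mul, norm_mul, Complex.norm_I, one_mul, List.length_cons,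
      pow_succ, ← mul_assoc, mul_comm]
    refine mul_le_mul ih ?_ (norm_nonneg _) (by positivity)
    simpa using abs_le_weight ν j

theorem derivBound_tsum_coeff (f : Smooth ι) (k : ℕ) :
    DerivBound k (∑' ν, ‖coeff (ofSmooth f) ν‖ * weight ν ^ k) f := fun w hw x => by
  have hs := (rapidDecay_coeff_ofSmooth f).summable_mul_weight_pow k
  rw [← (hasSum_coeff_ofSmooth_mul_char (iterPderiv w f) x).tsum_eq]
  refine tsum_of_norm_bounded hs.hasSum fun ν => ?_
  rw [norm_mul, norm_char_apply, mul_one]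
  refine (norm_coeff_ofSmooth_iterPderiv_le f w ν).trans ?_
  gcongr
  exact one_le_weight ν

/-- A distribution on the torus is determined by its Fourier coefficients: the Fourier series of a
test function converges to it in the topology of `C^∞`. -/
theorem Distr.ext_coeff {u v : Distr ι} (h : ∀ ν, coeff u ν = coeff v ν) : u = v := by
  have hpi : ((2 * Real.pi : ℝ) : ℂ) ≠ 0 := by exact_mod_cast (by positivity : 2 * Real.pi ≠ 0)
  suffices H : ∀ d : Distr ι, (∀ ν, coeff d ν = 0) → d = 0 by
    refine sub_eq_zero.1 (H _ fun ν => ?_)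
    rw [← coeffHom_apply, map_sub, coeffHom_apply, coeffHom_apply, h, sub_self]
  intro d hd
  have hd' : ∀ ν, d.1 (char ν) = 0 := fun ν => by
    have := hd (-ν)
    rw [coeff, neg_neg] at this
    exact (mul_eq_zero.1 this).resolve_left (pow_ne_zero _ (inv_ne_zero hpi))
  refine Subtype.ext (LinearMap.ext fun φ => ?_)
  obtain ⟨k, C, hC⟩ := d.2
  let g : (ι → ℤ) → ℝ := fun ν => ‖coeff (ofSmooth φ) ν‖ * weight ν ^ k
  have hbound : ∀ S : Finset (ι → ℤ), ‖d.1 φ‖ ≤ C * ∑' ν : {ν // ν ∉ S}, g ν := fun S => by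
    -- `d` kills trigonometric polynomials, so it sees only the tail `r` of the Fourier series.
    let r : Smooth ι := φ - ∑ ν ∈ S, coeff (ofSmooth φ) ν • char ν
    have hr : ∀ ν, coeff (ofSmooth r) ν = if ν ∈ S then 0 else coeff (ofSmooth φ) ν := fun ν => by
      have h1 : ∀ μ, ((2 * Real.pi : ℝ) : ℂ)⁻¹ ^ Fintype.card ι *
          (coeff (ofSmooth φ) μ * (ofSmooth (char (-ν))).1 (char μ))
            = if ν = μ then coeff (ofSmooth φ) μ else 0 := fun μ => by
        simp only [ofSmooth_char_char, neg_add_eq_zero]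
        split_ifs
        · rw [mul_left_comm, ← mul_pow, inv_mul_cancel₀ hpi, one_pow, mul_one]
        · simp
      rw [coeff_ofSmooth]
      simp only [r, map_sub, map_sum, map_smul, smul_eq_mul, mul_sub, Finset.mul_sum, h1,
        Finset.sum_ite_eq]
      rw [← coeff_ofSmooth]
      split_ifs <;> simp
    have h2 : d.1 φ = d.1 r := by simp [r, hd']
    have h3 : ∑' ν, ‖coeff (ofSmooth r) ν‖ * weight ν ^ k = ∑' ν : {ν // ν ∉ S}, g ν := by
      have h4 := tsum_subtype {ν | ν ∉ S} g
      refine Eq.trans (tsum_congr fun ν => ?_) h4.symm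
      by_cases hν : ν ∈ S <;> simp [hr, hν, g]
    rw [h2, ← h3]
    exact hC r _ (derivBound_tsum_coeff r k)
  have hlim := (tendsto_tsum_compl_atTop_zero g).const_mul C
  rw [mul_zero] at hlim
  exact norm_le_zero_iff.1 (ge_of_tendsto' hlim hbound)

end Fourier

/-! ### Partial Fourier coefficients -/

section Partial

variable {n N : ℕ}

theorem char_sumElim (ν : Fin n ⊕ Fin N → ℤ) (t : Fin n → ℝ) (x : Fin N → ℝ) :
    (char ν).1 (Sum.elim t x)
      = (char fun j => ν (Sum.inl j)).1 t * (char fun i => ν (Sum.inr i)).1 x := by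
  simp only [char, ← Complex.exp_add]
  congr 1
  rw [← mul_add, ← Complex.ofReal_add, Fintype.sum_sum_type]
  rfl

theorem hasSum_partialCoeff (f : Smooth (Fin n ⊕ Fin N)) (ξ : Fin N → ℤ) (t : Fin n → ℝ) :
    HasSum (fun ν : Fin n ⊕ Fin N → ℤ => (if (fun i => ν (Sum.inr i)) = ξ then
      coeff (ofSmooth f) ν else 0) * (char fun j => ν (Sum.inl j)).1 t) (partialCoeff f ξ t) := by
  have hpi : ((2 * Real.pi : ℝ) : ℂ) ≠ 0 := by exact_mod_cast (by positivity : 2 * Real.pi ≠ 0)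
  have hexp : ∀ x : Fin N → ℝ,
      Complex.exp (-Complex.I * ((∑ i, (ξ i : ℝ) * x i : ℝ) : ℂ)) = (char (-ξ)).1 x := fun x => by
    simp only [char, Pi.neg_apply, Int.cast_neg, neg_mul, Finset.sum_neg_distrib,
      Complex.ofReal_neg, mul_neg]
  have h1 : HasSum (fun ν : Fin n ⊕ Fin N → ℤ => torusIntegral fun x : Fin N → ℝ =>
      (char (-ξ)).1 x * (coeff (ofSmooth f) ν * (char ν).1 (Sum.elim t x)))
      (torusIntegral fun x : Fin N → ℝ => (char (-ξ)).1 x * f.1 (Sum.elim t x)) := by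
    refine hasSum_torusIntegral (B := fun ν => ‖coeff (ofSmooth f) ν‖) (fun ν => ?_)
      (fun ν x => ?_) (rapidDecay_coeff_ofSmooth f).summable_norm
      fun x => (hasSum_coeff_ofSmooth_mul_char f _).mul_left _
    · simp only [char_sumElim]
      exact (char (-ξ)).2.1.continuous.mul (continuous_const.mul
        (continuous_const.mul (char fun i => ν (Sum.inr i)).2.1.continuous))
    · simp [norm_char_apply]
  have h2 := h1.mul_left (((2 * Real.pi : ℝ) : ℂ)⁻¹ ^ N)
  simp only [partialCoeff, hexp]
  refine h2.congr_fun fun ν => ?_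
  have h3 : (torusIntegral fun x : Fin N → ℝ =>
      (char (-ξ)).1 x * (coeff (ofSmooth f) ν * (char ν).1 (Sum.elim t x)))
      = coeff (ofSmooth f) ν * (char fun j => ν (Sum.inl j)).1 t *
        (ofSmooth (char (-ξ))).1 (char fun i => ν (Sum.inr i)) := by
    rw [ofSmooth_apply]
    refine Eq.trans (congrArg torusIntegral (funext fun x => ?_))
      (MeasureTheory.integral_const_mul _ _)
    rw [char_sumElim]
    ring
  simp only [h3, ofSmooth_char_char, Fintype.card_fin, neg_add_eq_zero]
  by_cases h : (fun i => ν (Sum.inr i)) = ξ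
  · rw [if_pos h, if_pos h.symm, mul_left_comm, ← mul_pow, inv_mul_cancel₀ hpi, one_pow, mul_one]
  · rw [if_neg h, if_neg (Ne.symm h)]
    simp

theorem partialCoeff_eq_zero {f : Smooth (Fin n ⊕ Fin N)} {ξ : Fin N → ℤ}
    (h : ∀ η, coeff (ofSmooth f) (Sum.elim η ξ) = 0) (t : Fin n → ℝ) : partialCoeff f ξ t = 0 := by
  refine (hasSum_partialCoeff f ξ t).unique (hasSum_zero.congr_fun fun ν => ?_)
  split_ifs with hν
  · have : ν = Sum.elim (fun j => ν (Sum.inl j)) ξ := by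
      rw [← hν]
      exact (Sum.elim_comp_inl_inr ν).symm
    rw [this, h, zero_mul]
  · rw [zero_mul]

theorem torusIntegral_partialCoeff_mul_char (f : Smooth (Fin n ⊕ Fin N)) (η : Fin n → ℤ)
    (ξ : Fin N → ℤ) :
    torusIntegral (fun t => partialCoeff f ξ t * (char (-η)).1 t)
      = ((2 * Real.pi : ℝ) : ℂ) ^ n * coeff (ofSmooth f) (Sum.elim η ξ) := by
  have h1 : HasSum (fun ν : Fin n ⊕ Fin N → ℤ => torusIntegral fun t =>
      (if (fun i => ν (Sum.inr i)) = ξ then coeff (ofSmooth f) ν else 0)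
        * (char fun j => ν (Sum.inl j)).1 t * (char (-η)).1 t)
      (torusIntegral fun t => partialCoeff f ξ t * (char (-η)).1 t) := by
    refine hasSum_torusIntegral (B := fun ν => ‖coeff (ofSmooth f) ν‖) (fun ν => ?_)
      (fun ν x => ?_) (rapidDecay_coeff_ofSmooth f).summable_norm
      fun t => (hasSum_partialCoeff f ξ t).mul_right _
    · exact (continuous_const.mul (char _).2.1.continuous).mul (char (-η)).2.1.continuous
    · rw [norm_mul, norm_mul, norm_char_apply, norm_char_apply, mul_one, mul_one]
      split_ifs <;> simp
  refine h1.unique ((hasSum_ite_eq (Sum.elim η ξ)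
    (((2 * Real.pi : ℝ) : ℂ) ^ n * coeff (ofSmooth f) (Sum.elim η ξ))).congr_fun fun ν => ?_)
  have h3 : (torusIntegral fun t =>
      (if (fun i => ν (Sum.inr i)) = ξ then coeff (ofSmooth f) ν else 0)
        * (char fun j => ν (Sum.inl j)).1 t * (char (-η)).1 t)
      = (if (fun i => ν (Sum.inr i)) = ξ then coeff (ofSmooth f) ν else 0)
        * (ofSmooth (char fun j => ν (Sum.inl j))).1 (char (-η)) := by
    rw [ofSmooth_apply]
    refine Eq.trans (congrArg torusIntegral (funext fun x => ?_))
      (MeasureTheory.integral_const_mul _ _)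
    ring
  simp only [h3, ofSmooth_char_char, Fintype.card_fin, ← sub_eq_add_neg, sub_eq_zero]
  have h4 : ν = Sum.elim η ξ ↔
      (fun i => ν (Sum.inr i)) = ξ ∧ (fun j => ν (Sum.inl j)) = η := by
    constructor
    · rintro rfl
      exact ⟨rfl, rfl⟩
    · rintro ⟨rfl, rfl⟩
      exact (Sum.elim_comp_inl_inr ν).symm
  by_cases h : (fun i => ν (Sum.inr i)) = ξ <;> by_cases h' : (fun j => ν (Sum.inl j)) = η
  · rw [if_pos h, if_pos h', if_pos (h4.2 ⟨h, h'⟩), h4.2 ⟨h, h'⟩, mul_comm]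
  · rw [if_neg h', if_neg fun H => h' (h4.1 H).2, mul_zero]
  · rw [if_neg h, if_neg fun H => h (h4.1 H).1, zero_mul]
  · rw [if_neg h, if_neg fun H => h (h4.1 H).1, zero_mul]

end Partial

/-! ### The Koszul complex of a covector -/

section Koszul

variable {n p : ℕ}

/-- The sign of `dt_j ∧ dt_S` relative to `dt_{S ∪ {j}}`. -/
def insertSign (j : Fin n) (S : Finset (Fin n)) : ℂ := (-1) ^ (S.filter (· < j)).card

theorem insertSign_mul_self (j : Fin n) (S : Finset (Fin n)) :
    insertSign j S * insertSign j S = 1 := by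
  rw [insertSign, ← mul_pow]
  simp

theorem norm_insertSign (j : Fin n) (S : Finset (Fin n)) : ‖insertSign j S‖ = 1 := by
  simp [insertSign]

theorem insertSign_insert_of_lt {j k : Fin n} {S : Finset (Fin n)} (hk : k ∉ S) (h : k < j) :
    insertSign j (insert k S) = -insertSign j S := by
  rw [insertSign, Finset.filter_insert, if_pos h, Finset.card_insert_of_notMem (by simp [hk]),
    pow_succ, mul_neg_one]
  rfl

theorem insertSign_insert_of_le {j k : Fin n} {S : Finset (Fin n)} (h : j ≤ k) :
    insertSign j (insert k S) = insertSign j S := by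
  rw [insertSign, Finset.filter_insert, if_neg h.not_gt]
  rfl

/-- The exterior product with the covector `∑_j a_j dt_j`, on forms of mixed degree, i.e. functions
of `S ⊆ {1, …, n}`. -/
def wedgeCovector (a : Fin n → ℂ) (G : Finset (Fin n) → ℂ) (S : Finset (Fin n)) : ℂ :=
  ∑ j, if j ∈ S then insertSign j (S.erase j) * (a j * G (S.erase j)) else 0

/-- The contraction with the vector `∑_j τ_j ∂_{t_j}`, on forms of mixed degree. -/
def contractVector (τ : Fin n → ℂ) (G : Finset (Fin n) → ℂ) (S : Finset (Fin n)) : ℂ :=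
  ∑ j, if j ∈ S then 0 else insertSign j S * (τ j * G (insert j S))

/-- Cartan's identity: the contraction with `τ` is a homotopy, for the exterior product with `a`,
between `0` and the multiplication by `∑_j a_j τ_j`. -/
theorem wedgeCovector_contractVector_add (a τ : Fin n → ℂ) (G : Finset (Fin n) → ℂ)
    (S : Finset (Fin n)) :
    wedgeCovector a (contractVector τ G) S + contractVector τ (wedgeCovector a G) S
      = (∑ j, a j * τ j) * G S := by
  have key : ∀ j k : Fin n,
      (if j ∈ S then insertSign j (S.erase j) * (a j * (if k ∈ S.erase j then 0 else
        insertSign k (S.erase j) * (τ k * G (insert k (S.erase j))))) else 0)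
      + (if k ∈ S then 0 else insertSign k S * (τ k * (if j ∈ insert k S then
        insertSign j ((insert k S).erase j) * (a j * G ((insert k S).erase j)) else 0)))
      = if j = k then a j * τ j * G S else 0 := by
    intro j k
    -- For `j ≠ k` the terms cancel: exactly one of the two signs counts the other index.
    by_cases hjk : j = k
    · subst hjk
      by_cases hj : j ∈ S
      · simp only [hj, if_true, Finset.notMem_erase, if_false, Finset.insert_erase, add_zero]
        linear_combination (a j * τ j * G S) * insertSign_mul_self j (S.erase j)
      · simp only [hj, if_true, if_false, Finset.mem_insert_self, Finset.erase_insert, zero_add,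
          not_false_eq_true]
        linear_combination (a j * τ j * G S) * insertSign_mul_self j S
    · rw [if_neg hjk]
      by_cases hk : k ∈ S
      · simp [hk, Ne.symm hjk]
      by_cases hj : j ∈ S
      · obtain ⟨T, hjT, rfl⟩ : ∃ T, j ∉ T ∧ S = insert j T :=
          ⟨S.erase j, Finset.notMem_erase j S, (Finset.insert_erase hj).symm⟩
        have hkT : k ∉ T := fun h => hk (Finset.mem_insert_of_mem h)
        have h1 : (insert k (insert j T)).erase j = insert k T := by
          rw [Finset.insert_comm, Finset.erase_insert]
          simp [hjk, hjT]
        have hj2 : j ∈ insert k (insert j T) := by simp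
        rw [if_pos hj, if_neg hk, if_pos hj2, h1, Finset.erase_insert hjT, if_neg hkT]
        rcases lt_or_gt_of_ne hjk with h | h
        · rw [insertSign_insert_of_le h.le, insertSign_insert_of_lt hjT h]
          ring
        · rw [insertSign_insert_of_le h.le, insertSign_insert_of_lt hkT h]
          ring
      · simp [hj, hk, hjk]
  simp only [wedgeCovector, contractVector]
  have h1 : ∀ j : Fin n, (if j ∈ S then insertSign j (S.erase j) * (a j * ∑ k, if k ∈ S.erase j then 0
      else insertSign k (S.erase j) * (τ k * G (insert k (S.erase j)))) else 0)
      = ∑ k, if j ∈ S then insertSign j (S.erase j) * (a j * (if k ∈ S.erase j then 0 else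
        insertSign k (S.erase j) * (τ k * G (insert k (S.erase j))))) else 0 := fun j => by
    split_ifs
    · rw [Finset.mul_sum, Finset.mul_sum]
    · simp
  have h2 : ∀ k : Fin n, (if k ∈ S then 0 else insertSign k S * (τ k * ∑ j, if j ∈ insert k S then
        insertSign j ((insert k S).erase j) * (a j * G ((insert k S).erase j)) else 0))
      = ∑ j, if k ∈ S then 0 else insertSign k S * (τ k * (if j ∈ insert k S then
        insertSign j ((insert k S).erase j) * (a j * G ((insert k S).erase j)) else 0)) := fun k => by
    split_ifs
    · simp
    · rw [Finset.mul_sum, Finset.mul_sum]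
  rw [Finset.sum_congr rfl fun j _ => h1 j, Finset.sum_congr rfl fun k _ => h2 k,
    Finset.sum_comm (f := fun k j => if k ∈ S then 0 else insertSign k S * (τ k *
      (if j ∈ insert k S then
        insertSign j ((insert k S).erase j) * (a j * G ((insert k S).erase j)) else 0))),
    ← Finset.sum_add_distrib, Finset.sum_mul]
  refine Finset.sum_congr rfl fun j _ => ?_
  rw [← Finset.sum_add_distrib, Finset.sum_congr rfl fun k _ => key j k]
  simp

theorem wedgeCovector_wedgeCovector (a : Fin n → ℂ) (G : Finset (Fin n) → ℂ)
    (S : Finset (Fin n)) : wedgeCovector a (wedgeCovector a G) S = 0 := by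
  let term : Fin n → Fin n → ℂ := fun j k => if j ∈ S then insertSign j (S.erase j) *
    (a j * (if k ∈ S.erase j then insertSign k ((S.erase j).erase k) *
      (a k * G ((S.erase j).erase k)) else 0)) else 0
  have hsum : wedgeCovector a (wedgeCovector a G) S = ∑ j, ∑ k, term j k := by
    refine Finset.sum_congr rfl fun j _ => ?_
    simp only [term, wedgeCovector]
    split_ifs
    · rw [Finset.mul_sum, Finset.mul_sum]
    · simp
  have hanti : ∀ j k, j < k → term j k = -term k j := by
    intro j k hjk
    simp only [term]
    by_cases hj : j ∈ S <;> by_cases hk : k ∈ S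
    · obtain ⟨T, hjT, hkT, rfl⟩ : ∃ T, j ∉ T ∧ k ∉ T ∧ S = insert j (insert k T) := by
        refine ⟨(S.erase j).erase k, by simp, by simp, ?_⟩
        rw [Finset.insert_erase (Finset.mem_erase.2 ⟨hjk.ne', hk⟩), Finset.insert_erase hj]
      have hj' : j ∉ insert k T := by simp [hjk.ne, hjT]
      have hk' : k ∉ insert j T := by simp [hjk.ne', hkT]
      have h1 : (insert j (insert k T)).erase k = insert j T := by
        rw [Finset.insert_comm, Finset.erase_insert hk']
      rw [if_pos hj, if_pos hk, h1, Finset.erase_insert hj', if_pos (Finset.mem_insert_self k T),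
        if_pos (Finset.mem_insert_self j T), Finset.erase_insert hjT, Finset.erase_insert hkT,
        insertSign_insert_of_le hjk.le, insertSign_insert_of_lt hjT hjk]
      ring
    · simp [hj, hk]
    · simp [hj, hk]
    · simp [hj, hk]
  have hanti' : ∀ j k, term j k = -term k j := fun j k => by
    rcases lt_trichotomy j k with h | rfl | h
    · exact hanti j k h
    · simp [term]
    · rw [hanti k j h, neg_neg]
  have h1 : ∑ j, ∑ k, term j k = -∑ j, ∑ k, term j k := by
    conv_lhs => rw [Finset.sum_comm]
    rw [← Finset.sum_neg_distrib]
    refine Finset.sum_congr rfl fun j _ => ?_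
    rw [← Finset.sum_neg_distrib]
    exact Finset.sum_congr rfl fun k _ => hanti' k j
  rw [hsum]
  exact self_eq_neg.1 h1

/-- The extension by zero of a `p`-form to a form of mixed degree. -/
def extendForm (F : Form n p ℂ) (S : Finset (Fin n)) : ℂ :=
  if h : S.card = p then F ⟨S, h⟩ else 0

theorem extendForm_coe (F : Form n p ℂ) (K : {K : Finset (Fin n) // K.card = p}) :
    extendForm F K.1 = F K := dif_pos K.2

theorem norm_extendForm_le {F : Form n p ℂ} {B : ℝ} (hB : 0 ≤ B) (h : ∀ K, ‖F K‖ ≤ B)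
    (S : Finset (Fin n)) : ‖extendForm F S‖ ≤ B := by
  unfold extendForm
  split_ifs
  · exact h _
  · simpa

/-- The exterior product of a `p`-form with the covector `∑_j a_j dt_j`. -/
abbrev wedgeForm (a : Fin n → ℂ) (F : Form n p ℂ) : Form n (p + 1) ℂ :=
  wedgeOp (fun j z => a j * z) F

/-- The contraction of a `(p + 1)`-form with the vector `∑_j τ_j ∂_{t_j}`. -/
def contractForm (τ : Fin n → ℂ) (F : Form n (p + 1) ℂ) : Form n p ℂ :=
  fun K => contractVector τ (extendForm F) K.1

theorem extendForm_wedgeForm (a : Fin n → ℂ) (F : Form n p ℂ) :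
    extendForm (wedgeForm a F) = wedgeCovector a (extendForm F) := by
  ext S
  by_cases hS : S.card = p + 1
  · rw [extendForm, dif_pos hS]
    refine Finset.sum_congr rfl fun j _ => ?_
    split_ifs with hj
    · have hc : (S.erase j).card = p := by rw [Finset.card_erase_of_mem hj, hS]; rfl
      rw [Finset.sum_eq_single ⟨S.erase j, hc⟩]
      · simp [wedgeSign, hj, insertSign, extendForm, hc]
      · rintro K - hK
        rw [wedgeSign, if_neg, zero_smul]
        rintro ⟨hjK, rfl⟩
        exact hK (Subtype.ext (Finset.erase_insert hjK).symm)
      · simp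
    · refine Finset.sum_eq_zero fun K _ => ?_
      rw [wedgeSign, if_neg, zero_smul]
      rintro ⟨-, rfl⟩
      exact hj (Finset.mem_insert_self j _)
  · rw [extendForm, dif_neg hS, wedgeCovector]
    symm
    refine Finset.sum_eq_zero fun j _ => ?_
    split_ifs with hj
    · have hc : (S.erase j).card ≠ p := fun h => hS (by
        rw [← h, Finset.card_erase_add_one hj])
      simp [extendForm, hc]
    · rfl

theorem extendForm_contractForm (τ : Fin n → ℂ) (F : Form n (p + 1) ℂ) :
    extendForm (contractForm τ F) = contractVector τ (extendForm F) := by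
  ext S
  by_cases hS : S.card = p
  · rw [extendForm, dif_pos hS]
    rfl
  · rw [extendForm, dif_neg hS, contractVector]
    symm
    refine Finset.sum_eq_zero fun j _ => ?_
    split_ifs with hj
    · rfl
    · have hc : (insert j S).card ≠ p + 1 := fun h => hS (by
        rwa [Finset.card_insert_of_notMem hj, add_left_inj] at h)
      simp [extendForm, hc]

/-- The Koszul complex of `a` is exact where `∑_j a_j τ_j = 1`, with explicit primitive
`contractForm τ F` of a cocycle `F`. -/
theorem wedgeForm_contractForm {a τ : Fin n → ℂ} (hτ : ∑ j, a j * τ j = 1)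
    {F : Form n (p + 1) ℂ} (hF : wedgeForm a F = 0) : wedgeForm a (contractForm τ F) = F := by
  funext J
  have h := wedgeCovector_contractVector_add a τ (extendForm F) J.1
  rw [← extendForm_wedgeForm, hF, ← extendForm_contractForm, ← extendForm_wedgeForm, hτ, one_mul,
    extendForm_coe, extendForm_coe] at h
  simpa [contractVector, extendForm] using h

theorem wedgeForm_wedgeForm (a : Fin n → ℂ) (F : Form n p ℂ) :
    wedgeForm a (wedgeForm a F) = 0 := by
  funext J
  rw [← extendForm_coe (wedgeForm a (wedgeForm a F)), extendForm_wedgeForm, extendForm_wedgeForm,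
    wedgeCovector_wedgeCovector]
  rfl

theorem norm_wedgeForm_le (a : Fin n → ℂ) {F : Form n p ℂ} {B : ℝ} (hB : 0 ≤ B)
    (h : ∀ K, ‖F K‖ ≤ B) (J : {J : Finset (Fin n) // J.card = p + 1}) :
    ‖wedgeForm a F J‖ ≤ n * (‖a‖ * B) := by
  rw [← extendForm_coe (wedgeForm a F), extendForm_wedgeForm, wedgeCovector]
  calc _ ≤ ∑ _j : Fin n, ‖a‖ * B := by
        refine norm_sum_le_of_le _ fun j _ => ?_
        split_ifs
        · rw [norm_mul, norm_insertSign, one_mul, norm_mul]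
          exact mul_le_mul (norm_le_pi_norm a j) (norm_extendForm_le hB h _) (norm_nonneg _)
            (norm_nonneg _)
        · rw [norm_zero]
          positivity
    _ = _ := by simp

/-- In degree `p < n` the exterior product with `a` attains the norm of `a` on a monomial `dt_K`:
`K` avoids an index at which `|a_j|` is largest. -/
theorem exists_norm_wedgeForm_eq (a : Fin n → ℂ) (hp : p < n) :
    ∃ b : Form n p ℂ, (∀ K, ‖b K‖ ≤ 1) ∧ ∃ J, ‖wedgeForm a b J‖ = ‖a‖ := by
  have : Nonempty (Fin n) := ⟨⟨p, hp⟩⟩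
  obtain ⟨j, hj⟩ : ∃ j, ‖a j‖ = ‖a‖ := by
    obtain ⟨j, -, hj⟩ := Finset.exists_max_image Finset.univ (fun j => ‖a j‖) Finset.univ_nonempty
    exact ⟨j, le_antisymm (norm_le_pi_norm a j)
      ((pi_norm_le_iff_of_nonneg (norm_nonneg _)).2 fun i => hj i (Finset.mem_univ i))⟩
  obtain ⟨K, hK, hKp⟩ := Finset.exists_subset_card_eq (s := Finset.univ.erase j) (n := p) (by
    rw [Finset.card_erase_of_mem (Finset.mem_univ j), Finset.card_univ, Fintype.card_fin]
    omega)
  have hjK : j ∉ K := fun h => Finset.notMem_erase j _ (hK h)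
  refine ⟨Pi.single ⟨K, hKp⟩ 1, fun K' => ?_, ⟨insert j K, by
    rw [Finset.card_insert_of_notMem hjK, hKp]⟩, ?_⟩
  · rw [Pi.single_apply]
    split_ifs <;> simp
  · rw [← extendForm_coe (wedgeForm a _), extendForm_wedgeForm, wedgeCovector,
      Finset.sum_eq_single j, if_pos (Finset.mem_insert_self j K), Finset.erase_insert hjK,
      norm_mul, norm_insertSign, one_mul, norm_mul, hj]
    · simp [extendForm, hKp]
    · intro i _ hij
      split_ifs with hi
      · have hne : (insert j K).erase i ≠ K := fun h => by
          have : j ∈ (insert j K).erase i := by simp [Ne.symm hij]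
          exact hjK (h ▸ this)
        have : extendForm (Pi.single (⟨K, hKp⟩ : {K : Finset (Fin n) // K.card = p}) (1 : ℂ))
            ((insert j K).erase i) = 0 := by
          unfold extendForm
          split_ifs with hc
          · rw [Pi.single_apply, if_neg]
            simpa using hne
          · rfl
        rw [this, mul_zero, mul_zero]
      · rfl
    · simp

theorem map_wedgeOp {A B : Type} [AddCommGroup A] [AddCommGroup B] (φ : A →+ B)
    {T : Fin n → A → A} {T' : Fin n → B → B} (h : ∀ j x, φ (T j x) = T' j (φ x))
    (u : Form n p A) (J : {J : Finset (Fin n) // J.card = p + 1}) :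
    φ (wedgeOp T u J) = wedgeOp T' (fun K => φ (u K)) J := by
  simp only [wedgeOp, map_sum, map_zsmul, h]

end Koszul

/-! ### The symbol of the complex and small divisors -/

section Symbol

variable {n N : ℕ} {m : Fin n → ℝ} (P : ∀ j, ToroidalSymbol N (m j))

/-- The symbol of the complex at the frequency `ν = (η, ξ)`. -/
abbrev symbolAt (ν : Fin n ⊕ Fin N → ℤ) : Fin n → ℂ :=
  symbolLL P (fun j => ν (Sum.inl j)) (fun i => ν (Sum.inr i))

theorem coeff_I_smul_opL (j : Fin n) (u : Distr (Fin n ⊕ Fin N)) (ν : Fin n ⊕ Fin N → ℤ) :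
    coeff (Complex.I • opL P j u) ν = symbolAt P ν j * coeff u ν := by
  rw [← coeffHom_apply, map_smul, opL, LinearMap.add_apply, map_add, LinearMap.smul_apply, map_smul,
    coeffHom_apply, coeffHom_apply, coeff_distr_pderiv, pseudoDiff, coeff_multiplier]
  simp only [symbolLL, smul_eq_mul]
  linear_combination (-(Complex.I * (ν (Sum.inl j) : ℂ) * coeff u ν)) * Complex.I_sq

theorem coeff_opLL {p : ℕ} (u : Form n p (Distr (Fin n ⊕ Fin N))) (ν : Fin n ⊕ Fin N → ℤ)
    (J : {J : Finset (Fin n) // J.card = p + 1}) :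
    coeff (opLL P p u J) ν = wedgeForm (symbolAt P ν) (fun K => coeff (u K) ν) J :=
  map_wedgeOp (coeffHom ν).toAddMonoidHom (fun j v => coeff_I_smul_opL P j v ν) u J

theorem weight_eq_freqNorm_sq_add_one (ν : Fin n ⊕ Fin N → ℤ) :
    weight ν = freqNorm (fun j => ν (Sum.inl j)) (fun i => ν (Sum.inr i)) ^ 2 + 1 := by
  rw [freqNorm, Real.sq_sqrt (by positivity), weight, Fintype.sum_sum_type, add_comm]

theorem one_le_freqNorm {η : Fin n → ℤ} {ξ : Fin N → ℤ} (h : (η, ξ) ≠ (0, 0)) :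
    1 ≤ freqNorm η ξ := by
  rw [freqNorm, Real.one_le_sqrt]
  have key : ∀ {κ : Type} [Fintype κ] (μ : κ → ℤ), μ ≠ 0 → (1 : ℝ) ≤ ∑ i, (μ i : ℝ) ^ 2 := by
    intro κ _ μ hμ
    obtain ⟨i, hi⟩ := Function.ne_iff.1 hμ
    have h1 : (1 : ℝ) ≤ (μ i : ℝ) ^ 2 := by
      rw [← sq_abs]
      exact one_le_pow₀ (by exact_mod_cast Int.one_le_abs hi)
    exact h1.trans (Finset.single_le_sum (f := fun i => (μ i : ℝ) ^ 2) (fun i _ => sq_nonneg _)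
      (Finset.mem_univ i))
  have h1 : 0 ≤ ∑ j, (η j : ℝ) ^ 2 := Finset.sum_nonneg fun i _ => sq_nonneg _
  have h2 : 0 ≤ ∑ j, (ξ j : ℝ) ^ 2 := Finset.sum_nonneg fun i _ => sq_nonneg _
  by_cases hη : η = 0
  · have hξ : ξ ≠ 0 := fun hξ => h (by rw [hη, hξ])
    linarith [key ξ hξ]
  · linarith [key η hη]

/-- The nonzero values of the symbol are bounded below by a negative power of the frequency; a
single exponent `k` also carries the constant. -/
def SmallDivisorBound : Prop :=
  ∃ k : ℕ, ∀ ν : Fin n ⊕ Fin N → ℤ, symbolAt P ν ≠ 0 →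
    1 ≤ ‖symbolAt P ν‖ * ((k + 1) * weight ν ^ k)

theorem smallDivisorBound_iff :
    SmallDivisorBound P ↔
      ∃ C > (0 : ℝ), ∃ lam > (0 : ℝ), ∀ (η : Fin n → ℤ) (ξ : Fin N → ℤ), (η, ξ) ≠ (0, 0) →
        symbolLL P η ξ ≠ 0 → ‖symbolLL P η ξ‖ ≥ C * freqNorm η ξ ^ (-lam) := by
  constructor
  · rintro ⟨k, hk⟩
    refine ⟨((k + 1) * 2 ^ k)⁻¹, by positivity, 2 * k + 1, by positivity, fun η ξ h0 h => ?_⟩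
    have h1 := hk (Sum.elim η ξ) h
    have h2 := weight_eq_freqNorm_sq_add_one (Sum.elim η ξ)
    simp only [Sum.elim_inl, Sum.elim_inr] at h1 h2
    have h3 := one_le_freqNorm h0
    set r := freqNorm η ξ
    have h4 : weight (Sum.elim η ξ) ≤ 2 * r ^ 2 := by nlinarith
    have h5 : weight (Sum.elim η ξ) ^ k ≤ 2 ^ k * r ^ (2 * k + 1) := by
      have hw := one_le_weight (Sum.elim η ξ)
      calc weight (Sum.elim η ξ) ^ k ≤ (2 * r ^ 2) ^ k := by gcongr
        _ = 2 ^ k * r ^ (2 * k) := by rw [mul_pow, ← pow_mul]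
        _ ≤ 2 ^ k * r ^ (2 * k + 1) := by
          gcongr
          omega
    have hr : r ^ (-(2 * (k : ℝ) + 1)) = (r ^ (2 * k + 1))⁻¹ := by
      rw [Real.rpow_neg (by linarith), ← Real.rpow_natCast]
      push_cast
      rfl
    rw [hr, ← mul_inv, ge_iff_le, inv_le_iff_one_le_mul₀ (by positivity)]
    refine h1.trans (mul_le_mul_of_nonneg_left ?_ (norm_nonneg _))
    rw [mul_assoc]
    gcongr
  · rintro ⟨C, hC, lam, hlam, H⟩
    -- `ν = 0` is excluded in the hypothesis; its finite contribution is absorbed by the constant.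
    let k : ℕ := max ⌈lam⌉₊ (max ⌈C⁻¹⌉₊ ⌈‖symbolAt P 0‖⁻¹⌉₊)
    have hk1 : lam ≤ k := (Nat.le_ceil _).trans (by exact_mod_cast le_max_left _ _)
    have hk2 : C⁻¹ ≤ k := (Nat.le_ceil _).trans (by
      exact_mod_cast (le_max_left _ _).trans (le_max_right _ _))
    have hk3 : ‖symbolAt P 0‖⁻¹ ≤ k := (Nat.le_ceil _).trans (by
      exact_mod_cast (le_max_right _ _).trans (le_max_right _ _))
    refine ⟨k, fun ν hν => ?_⟩
    have hw := one_le_weight ν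
    have hpos : 0 < ‖symbolAt P ν‖ := norm_pos_iff.2 hν
    by_cases h0 : ν = 0
    · subst h0
      have h1 : (1 : ℝ) ≤ weight (0 : Fin n ⊕ Fin N → ℤ) ^ k := one_le_pow₀ hw
      rw [inv_le_iff_one_le_mul₀ hpos] at hk3
      calc 1 ≤ (k : ℝ) * ‖symbolAt P 0‖ := hk3
        _ ≤ ((k + 1) * weight (0 : Fin n ⊕ Fin N → ℤ) ^ k) * ‖symbolAt P 0‖ := by
          refine mul_le_mul_of_nonneg_right ?_ hpos.le
          nlinarith [Nat.cast_nonneg (α := ℝ) k]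
        _ = _ := mul_comm _ _
    · have h0' : ((fun j => ν (Sum.inl j)), (fun i => ν (Sum.inr i)))
          ≠ ((0 : Fin n → ℤ), (0 : Fin N → ℤ)) := fun h => h0 (by
        rw [Prod.mk.injEq] at h
        ext (j | i)
        · exact congrFun h.1 j
        · exact congrFun h.2 i)
      have h1 := H _ _ h0' hν
      have h2 := weight_eq_freqNorm_sq_add_one ν
      have h3 := one_le_freqNorm h0'
      set r := freqNorm (fun j => ν (Sum.inl j)) (fun i => ν (Sum.inr i))
      have h4 : r ^ lam ≤ weight ν ^ k := by
        calc r ^ lam ≤ r ^ (k : ℝ) := Real.rpow_le_rpow_of_exponent_le h3 hk1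
          _ = r ^ k := Real.rpow_natCast _ _
          _ ≤ weight ν ^ k := by
            gcongr
            nlinarith
      have hrpos : 0 < r ^ lam := Real.rpow_pos_of_pos (by linarith) _
      rw [Real.rpow_neg (by linarith), ge_iff_le, ← div_eq_mul_inv, div_le_iff₀ hrpos] at h1
      rw [inv_le_iff_one_le_mul₀ hC] at hk2
      calc 1 ≤ (k : ℝ) * C := hk2
        _ ≤ (k + 1) * (‖symbolAt P ν‖ * weight ν ^ k) := by
          refine mul_le_mul (by linarith) (h1.trans ?_) hC.le (by positivity)
          exact mul_le_mul_of_nonneg_left h4 hpos.le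
        _ = _ := by ring

end Symbol

/-! ### Integral constant forms -/

section Integral

variable {n N : ℕ}

theorem isIntegralForm_intCast (l : Fin n → ℤ) : IsIntegralForm fun j => (l j : ℂ) := by
  refine ⟨fun j => by simp, ?_⟩
  rintro γ hγ ⟨k, hk⟩
  refine ⟨∑ j, l j * k j, ?_⟩
  have hd : ∀ s : ℝ, HasDerivAt (fun s => ∑ j, (l j : ℝ) * γ s j)
      (∑ j, (l j : ℝ) * deriv γ s j) s := fun s => by
    have h1 := (hγ.differentiable one_ne_zero s).hasDerivAt
    rw [hasDerivAt_pi] at h1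
    exact HasDerivAt.fun_sum fun j _ => (h1 j).const_mul _
  have hc : Continuous fun s => ∑ j, (l j : ℝ) * deriv γ s j := by
    have := hγ.continuous_deriv le_rfl
    fun_prop
  have h2 := intervalIntegral.integral_eq_sub_of_hasDerivAt (a := (0 : ℝ)) (b := 1)
    (fun s _ => hd s) (hc.intervalIntegrable _ _)
  simp only [Complex.intCast_re]
  rw [h2, hk, ← Finset.sum_sub_distrib]
  simp only [Pi.add_apply]
  push_cast
  rw [Finset.mul_sum]
  refine Finset.sum_congr rfl fun j _ => ?_
  field_simp
  ring

theorem IsIntegralForm.exists_intCast_eq {c : Fin n → ℂ} (hc : IsIntegralForm c) (j : Fin n) :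
    ∃ l : ℤ, c j = l := by
  have hd : ∀ s : ℝ, HasDerivAt (fun s : ℝ => s • (Pi.single j (2 * Real.pi) : Fin n → ℝ))
      (Pi.single j (2 * Real.pi)) s := fun s => by
    simpa using (hasDerivAt_id s).smul_const (Pi.single j (2 * Real.pi) : Fin n → ℝ)
  obtain ⟨l, hl⟩ := hc.2 (fun s => s • Pi.single j (2 * Real.pi)) (by fun_prop)
    ⟨Pi.single j 1, by
      ext i
      by_cases h : i = j
      · subst h
        simp
      · simp [h]⟩
  refine ⟨l, Complex.ext ?_ (by simpa using hc.1 j)⟩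
  simp only [fun s => (hd s).deriv, Pi.single_apply, mul_ite, mul_zero, Finset.sum_ite_eq',
    Finset.mem_univ, if_true, intervalIntegral.integral_const, sub_zero, one_smul] at hl
  rw [Complex.intCast_re, ← hl]
  field_simp

/-- At a zero `ν` of the symbol, the compatibility condition forces `f̂(ν) = 0`. -/
theorem coeff_eq_zero_of_mem_compatSet {m : Fin n → ℝ} {P : ∀ j, ToroidalSymbol N (m j)} {p : ℕ}
    {f : Form n (p + 1) (Smooth (Fin n ⊕ Fin N))} (hf : f ∈ compatSet P p)
    {ν : Fin n ⊕ Fin N → ℤ} (hν : symbolAt P ν = 0)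
    (J : {J : Finset (Fin n) // J.card = p + 1}) : coeff (ofSmooth (f J)) ν = 0 := by
  set η : Fin n → ℤ := fun j => ν (Sum.inl j)
  set ξ : Fin N → ℤ := fun i => ν (Sum.inr i)
  have hP : (fun j => (P j).toFun ξ) = fun j => ((-η j : ℤ) : ℂ) := by
    funext j
    have := congrFun hν j
    simp only [symbolLL, Pi.zero_apply, mul_eq_zero, Complex.I_ne_zero, false_or] at this
    push_cast
    linear_combination this
  have hint : IsIntegralForm fun j => (P j).toFun ξ := hP ▸ isIntegralForm_intCast _
  let L : (Fin n → ℝ) →L[ℝ] ℝ :=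
    ∑ i, ((-η i : ℤ) : ℝ) • ContinuousLinearMap.proj (R := ℝ) i
  have hL : ∀ v, L v = ∑ i, ((-η i : ℤ) : ℝ) * v i := fun v => by simp [L]
  have hprim : IsPrimitive L fun j => (P j).toFun ξ := by
    refine ⟨L.contDiff, fun t v => ?_⟩
    rw [L.fderiv, hP, hL]
    push_cast
    rfl
  obtain ⟨g, hg⟩ := hf.2 ξ hint L hprim
  have hchar : ∀ t, Complex.exp (Complex.I * (L t : ℂ)) = (char (-η)).1 t := fun t => by
    rw [hL]
    rfl
  have h1 : torusIntegral (torusExtDeriv g J).1 = 0 := by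
    have h2 : ∀ φ : Smooth (Fin n), torusIntegral φ.1 = (ofSmooth (char 0)).1 φ := fun φ => by
      rw [ofSmooth_apply]
      simp only [char_zero_apply, one_mul]
    rw [h2]
    have h3 := map_wedgeOp (ofSmooth (char (0 : Fin n → ℤ))).1.toAddMonoidHom
      (T := fun j v => pderiv j v) (T' := fun _ _ => 0)
      (fun j φ => (ofSmooth_char_pderiv 0 φ j).trans (by simp)) g J
    refine h3.trans ?_
    simp [wedgeOp]
  have h4 := torusIntegral_partialCoeff_mul_char (f J) η ξ
  have hpi : ((2 * Real.pi : ℝ) : ℂ) ≠ 0 := by exact_mod_cast (by positivity : 2 * Real.pi ≠ 0)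
  have h5 : (fun t => partialCoeff (f J) ξ t * (char (-η)).1 t) = (torusExtDeriv g J).1 :=
    funext fun t => by rw [← hchar]; exact hg J t
  have hνe : Sum.elim η ξ = ν := Sum.elim_comp_inl_inr ν
  rw [h5, h1, hνe] at h4
  exact (mul_eq_zero.1 h4.symm).resolve_left (pow_ne_zero _ hpi)

end Integral

/-! ### Solvability from the small divisor bound -/

section Sufficiency

variable {n N : ℕ}

/-- The vector `ā / ∑ |a_j|²` dual to the covector `a`: `∑_j a_j τ_j = 1` unless `a = 0`, when it is `0`. -/
def dualVector (a : Fin n → ℂ) (j : Fin n) : ℂ :=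
  starRingEnd ℂ (a j) / ((∑ i, ‖a i‖ ^ 2 : ℝ) : ℂ)

theorem sq_norm_le_sum (a : Fin n → ℂ) : ‖a‖ ^ 2 ≤ ∑ i, ‖a i‖ ^ 2 := by
  have h : 0 ≤ ∑ i, ‖a i‖ ^ 2 := Finset.sum_nonneg fun i _ => sq_nonneg _
  rw [← Real.le_sqrt (norm_nonneg _) h, pi_norm_le_iff_of_nonneg (Real.sqrt_nonneg _)]
  exact fun i => Real.le_sqrt_of_sq_le
    (Finset.single_le_sum (f := fun i => ‖a i‖ ^ 2) (fun i _ => sq_nonneg _) (Finset.mem_univ i))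

theorem sum_mul_dualVector {a : Fin n → ℂ} (ha : a ≠ 0) : ∑ j, a j * dualVector a j = 1 := by
  have h : (0 : ℝ) < ∑ i, ‖a i‖ ^ 2 := by
    have := norm_pos_iff.2 ha
    exact lt_of_lt_of_le (by positivity) (sq_norm_le_sum a)
  simp only [dualVector, ← mul_div_assoc, Complex.mul_conj']
  rw [← Finset.sum_div]
  push_cast
  exact div_self (by exact_mod_cast h.ne')

theorem norm_dualVector_le (a : Fin n → ℂ) (j : Fin n) : ‖dualVector a j‖ ≤ ‖a‖⁻¹ := by
  by_cases ha : a = 0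
  · simp [ha, dualVector]
  have hpos := norm_pos_iff.2 ha
  have h := sq_norm_le_sum a
  have hsum : 0 < ∑ i, ‖a i‖ ^ 2 := lt_of_lt_of_le (by positivity) h
  rw [dualVector, norm_div, RCLike.norm_conj, Complex.norm_real, Real.norm_of_nonneg hsum.le,
    div_le_iff₀ hsum]
  calc ‖a j‖ ≤ ‖a‖ := norm_le_pi_norm a j
    _ = ‖a‖⁻¹ * ‖a‖ ^ 2 := by field_simp
    _ ≤ _ := by gcongr

theorem SmallDivisorBound.globallySolvable {m : Fin n → ℝ} {P : ∀ j, ToroidalSymbol N (m j)}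
    (h : SmallDivisorBound P) (p : ℕ) : GloballySolvable P p := by
  intro f hf
  obtain ⟨k, hk⟩ := h
  have hσ : ∀ j, PolyGrowth fun ν => dualVector (symbolAt P ν) j := fun j => by
    refine ⟨k + 1, k, fun ν => (norm_dualVector_le _ _).trans ?_⟩
    have hw := one_le_weight ν
    by_cases hν : symbolAt P ν = 0
    · rw [hν]
      simp only [norm_zero, inv_zero]
      positivity
    · rw [inv_le_iff_one_le_mul₀' (norm_pos_iff.2 hν)]
      exact hk ν hν
  -- `u` is the contraction of `f` with the vector of multipliers `dualVector (symbolAt P ν)`;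
  -- `fext` extends `f` by zero to all index sets.
  let fext : Finset (Fin n) → Distr (Fin n ⊕ Fin N) := fun S =>
    if h : S.card = p + 1 then ofSmooth (f ⟨S, h⟩) else 0
  let u : Form n p (Distr (Fin n ⊕ Fin N)) := fun K => ∑ j, if j ∈ K.1 then 0 else
    insertSign j K.1 • multiplier _ (hσ j) (fext (insert j K.1))
  have hfext : ∀ S ν, coeff (fext S) ν = extendForm (fun J => coeff (ofSmooth (f J)) ν) S := by
    intro S ν
    simp only [fext, extendForm]
    split_ifs
    · rfl
    · exact map_zero (coeffHom ν)
  have hu : ∀ K ν, coeff (u K) ν = contractForm (dualVector (symbolAt P ν))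
      (fun J => coeff (ofSmooth (f J)) ν) K := by
    intro K ν
    rw [← coeffHom_apply, map_sum]
    refine Finset.sum_congr rfl fun j _ => ?_
    split_ifs
    · exact map_zero _
    · rw [map_smul, coeffHom_apply, coeff_multiplier, hfext, smul_eq_mul]
  refine ⟨u, funext fun J => Distr.ext_coeff fun ν => ?_⟩
  rw [coeff_opLL]
  simp only [hu]
  by_cases hν : symbolAt P ν = 0
  · rw [coeff_eq_zero_of_mem_compatSet hf hν, hν]
    simp [wedgeOp]
  · have hclosed : wedgeForm (symbolAt P ν) (fun J => coeff (ofSmooth (f J)) ν) = 0 := by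
      funext J'
      rw [← coeff_opLL, hf.1]
      exact map_zero (coeffHom ν)
    exact congrFun (wedgeForm_contractForm (sum_mul_dualVector hν) hclosed) J

end Sufficiency

/-! ### Failure of solvability without the small divisor bound -/

section Necessity

variable {n N : ℕ}

theorem GloballySolvable.smallDivisorBound {m : Fin n → ℝ} {P : ∀ j, ToroidalSymbol N (m j)}
    {p : ℕ} (hp : p < n) (h : GloballySolvable P p) : SmallDivisorBound P := by
  by_contra hcon
  simp only [SmallDivisorBound, not_exists, not_forall, not_le, exists_prop] at hcon
  choose freq hne hlt using hcon
  have hw : ∀ ν : Fin n ⊕ Fin N → ℤ, 1 ≤ weight ν := one_le_weight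
  -- Along the exceptional frequencies the square root of the symbol decays rapidly.
  have hsqrt : ∀ k l : ℕ, 2 * l ≤ k →
      (k + 1) * (√‖symbolAt P (freq k)‖ * weight (freq k) ^ l) ^ 2 ≤ 1 := by
    intro k l hkl
    refine le_trans ?_ (hlt k).le
    rw [mul_pow, Real.sq_sqrt (norm_nonneg _), ← pow_mul, mul_comm l 2, mul_left_comm]
    have := pow_le_pow_right₀ (hw (freq k)) hkl
    gcongr
  choose b hb1 Jb hJb using fun ν => exists_norm_wedgeForm_eq (symbolAt P ν) hp
  let B : (Fin n ⊕ Fin N → ℤ) → Form n p ℂ := fun ν K => open scoped Classical in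
    if ν ∈ Set.range freq then ((√‖symbolAt P ν‖)⁻¹ : ℝ) * b ν K else 0
  have hBnorm : ∀ k J, ‖wedgeForm (symbolAt P (freq k)) (B (freq k)) J‖
      ≤ n * √‖symbolAt P (freq k)‖ := by
    intro k J
    have h1 := norm_wedgeForm_le (symbolAt P (freq k)) (F := B (freq k))
      (B := (√‖symbolAt P (freq k)‖)⁻¹) (by positivity) (fun K => by
        simp only [B, Set.mem_range_self, if_true, norm_mul, Complex.norm_real]
        rw [Real.norm_of_nonneg (by positivity)]
        exact mul_le_of_le_one_right (by positivity) (hb1 _ K)) J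
    rwa [← div_eq_mul_inv, Real.div_sqrt] at h1
  have hB0 : ∀ ν, ν ∉ Set.range freq → B ν = 0 := fun ν hν => by
    funext K
    simp only [B, if_neg hν, Pi.zero_apply]
  have hwedge0 : ∀ (a : Fin n → ℂ), wedgeForm a (0 : Form n p ℂ) = 0 := fun a => by
    funext J
    simp [wedgeOp]
  have hdecay : ∀ J, RapidDecay fun ν => wedgeForm (symbolAt P ν) (B ν) J := by
    intro J l
    have hterm : ∀ k, 0 ≤ √‖symbolAt P (freq k)‖ * weight (freq k) ^ l := fun k => by
      have := hw (freq k)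
      positivity
    refine ⟨n * (1 + ∑ k ∈ Finset.range (2 * l),
      √‖symbolAt P (freq k)‖ * weight (freq k) ^ l), fun ν => ?_⟩
    have hsum := Finset.sum_nonneg fun k (_ : k ∈ Finset.range (2 * l)) => hterm k
    by_cases hν : ν ∈ Set.range freq
    · obtain ⟨k, rfl⟩ := hν
      have hwk := hw (freq k)
      refine (mul_le_mul_of_nonneg_right (hBnorm k J) (by positivity)).trans ?_
      rw [mul_assoc]
      refine mul_le_mul_of_nonneg_left ?_ (Nat.cast_nonneg n)
      by_cases hk : k < 2 * l
      · have := Finset.single_le_sum (f := fun k => √‖symbolAt P (freq k)‖ * weight (freq k) ^ l)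
          (fun k _ => hterm k) (Finset.mem_range.2 hk)
        linarith
      · have h1 := hsqrt k l (not_lt.1 hk)
        have h2 := hterm k
        have h3 : (√‖symbolAt P (freq k)‖ * weight (freq k) ^ l) ^ 2 ≤ 1 := by
          nlinarith [Nat.cast_nonneg (α := ℝ) k,
            sq_nonneg (√‖symbolAt P (freq k)‖ * weight (freq k) ^ l)]
        have h4 := (sq_le_one_iff₀ h2).1 h3
        linarith
    · simp only [hB0 ν hν, hwedge0, Pi.zero_apply, norm_zero, zero_mul]
      positivity
  let f : Form n (p + 1) (Smooth (Fin n ⊕ Fin N)) := fun J => ofCoeff _ (hdecay J)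
  have hfc : ∀ J ν, coeff (ofSmooth (f J)) ν = wedgeForm (symbolAt P ν) (B ν) J := fun J ν =>
    coeff_ofSmooth_ofCoeff (hdecay J) ν
  have hf : f ∈ compatSet P p := by
    refine ⟨funext fun M => Distr.ext_coeff fun ν => ?_, fun ξ hξ ψ _ => ?_⟩
    · rw [coeff_opLL]
      simp only [hfc]
      exact (congrFun (wedgeForm_wedgeForm (symbolAt P ν) (B ν)) M).trans
        (map_zero (coeffHom ν)).symm
    · -- For integral `ξ` the symbol takes values in `iℤ^n`, so it is zero where its norm is `< 1`,
      -- and there are no exceptional frequencies `(η, ξ)`.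
      have hnot : ∀ η : Fin n → ℤ, Sum.elim η ξ ∉ Set.range freq := by
        rintro η ⟨k, hk⟩
        refine hne k (funext fun j => ?_)
        have h1 : ‖symbolAt P (freq k)‖ < 1 := by
          have h2 : (1 : ℝ) ≤ (k + 1) * weight (freq k) ^ k :=
            one_le_mul_of_one_le_of_one_le (by linarith [Nat.cast_nonneg (α := ℝ) k])
              (one_le_pow₀ (hw _))
          exact (le_mul_of_one_le_right (norm_nonneg _) h2).trans_lt (hlt k)
        obtain ⟨l, hl⟩ := hξ.exists_intCast_eq j
        have h2 := (norm_le_pi_norm (symbolAt P (freq k)) j).trans_lt h1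
        rw [hk] at h2 ⊢
        simp only [symbolLL, Sum.elim_inl, Sum.elim_inr] at h2 ⊢
        rw [hl, norm_mul, Complex.norm_I, one_mul, ← Int.cast_add, Complex.norm_intCast] at h2
        have h3 : η j + l = 0 := Int.abs_lt_one_iff.1 (by exact_mod_cast h2)
        rw [hl, ← Int.cast_add, h3]
        simp
      refine ⟨0, fun J t => ?_⟩
      have h1 : partialCoeff (f J) ξ t = 0 := partialCoeff_eq_zero (fun η => by
        rw [hfc, hB0 _ (hnot η), hwedge0]
        rfl) t
      change partialCoeff (f J) ξ t * _ = _
      rw [h1, zero_mul]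
      simp [torusExtDeriv, wedgeOp]
  obtain ⟨u, hu⟩ := h f hf
  choose C l hC0 hC using fun K => exists_coeff_bound (u K)
  let D : ℝ := ∑ K, C K
  let r : ℕ := ∑ K, l K
  have hbound : ∀ K ν, ‖coeff (u K) ν‖ ≤ D * weight ν ^ r := fun K ν => by
    refine (hC K ν).trans (mul_le_mul ?_ ?_ ?_ ?_)
    · exact Finset.single_le_sum (f := C) (fun K _ => hC0 K) (Finset.mem_univ K)
    · exact pow_le_pow_right₀ (hw ν)
        (Finset.single_le_sum (f := l) (fun K _ => Nat.zero_le _) (Finset.mem_univ K))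
    · have := hw ν
      positivity
    · exact Finset.sum_nonneg fun K _ => hC0 K
  have hD : 0 ≤ D := Finset.sum_nonneg fun K _ => hC0 K
  have hkey : ∀ k : ℕ, 2 * r ≤ k → (k + 1 : ℝ) ≤ (n * D) ^ 2 := by
    intro k hk
    set s := √‖symbolAt P (freq k)‖ with hs
    have hspos : 0 < s := Real.sqrt_pos.2 (norm_pos_iff.2 (hne k))
    have hss : s * s = ‖symbolAt P (freq k)‖ := Real.mul_self_sqrt (norm_nonneg _)
    have hwk := hw (freq k)
    set J := Jb (freq k)
    have h1 : ‖wedgeForm (symbolAt P (freq k)) (B (freq k)) J‖ = s := by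
      have hBs : B (freq k) = fun K => ((s⁻¹ : ℝ) : ℂ) * b (freq k) K := by
        funext K
        simp only [B, Set.mem_range_self, if_true, hs]
      have h2 := map_wedgeOp (AddMonoidHom.mulLeft ((s⁻¹ : ℝ) : ℂ))
        (T := fun j z => symbolAt P (freq k) j * z) (T' := fun j z => symbolAt P (freq k) j * z)
        (fun j z => mul_left_comm _ _ _) (b (freq k)) J
      rw [hBs]
      refine (congrArg norm h2.symm).trans ?_
      change ‖((s⁻¹ : ℝ) : ℂ) * wedgeForm (symbolAt P (freq k)) (b (freq k)) J‖ = s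
      rw [norm_mul, hJb, Complex.norm_real, Real.norm_of_nonneg (by positivity), ← hss]
      field_simp
    have h2 : ‖wedgeForm (symbolAt P (freq k)) (B (freq k)) J‖
        ≤ n * (‖symbolAt P (freq k)‖ * (D * weight (freq k) ^ r)) := by
      rw [← hfc, ← congrFun hu J, coeff_opLL]
      exact norm_wedgeForm_le _ (by positivity) (fun K => hbound K _) J
    rw [h1, ← hss] at h2
    have h3 : 1 ≤ n * D * (s * weight (freq k) ^ r) := by
      refine le_of_mul_le_mul_left ?_ hspos
      calc s * 1 = s := mul_one s
        _ ≤ _ := h2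
        _ = _ := by ring
    have h4 := hsqrt k r hk
    calc (k + 1 : ℝ) ≤ (k + 1) * (n * D * (s * weight (freq k) ^ r)) ^ 2 :=
          le_mul_of_one_le_right (by positivity) (one_le_pow₀ h3)
      _ = (n * D) ^ 2 * ((k + 1) * (s * weight (freq k) ^ r) ^ 2) := by ring
      _ ≤ (n * D) ^ 2 := mul_le_of_le_one_right (sq_nonneg _) h4
  obtain ⟨k, hk⟩ := exists_nat_gt ((n * D) ^ 2)
  have h1 := hkey (max k (2 * r)) (le_max_right _ _)
  have h2 : (k : ℝ) ≤ (max k (2 * r) : ℕ) := by exact_mod_cast le_max_left _ _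
  linarith

end Necessity

end ToroidalComplex

end

theorem mainTheorem1 (n N : ℕ) (m : Fin n → ℝ)
    (P : ∀ j : Fin n, ToroidalComplex.ToroidalSymbol N (m j)) (p : ℕ) (hp : p < n) :
    ToroidalComplex.GloballySolvable P p ↔
      ∃ C > (0 : ℝ), ∃ lam > (0 : ℝ), ∀ (η : Fin n → ℤ) (ξ : Fin N → ℤ), (η, ξ) ≠ (0, 0) →
        ToroidalComplex.symbolLL P η ξ ≠ 0 →
          ‖ToroidalComplex.symbolLL P η ξ‖ ≥ C * ToroidalComplex.freqNorm η ξ ^ (-lam) := by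
  rw [← ToroidalComplex.smallDivisorBound_iff]
  exact ⟨fun h => h.smallDivisorBound hp, fun h => h.globallySolvable p⟩
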